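/- Let $N\ge 1$ and let $f:\mathbb{C}^N\to\mathbb{C}^N$ be complex entire with $f(\mathbb{R}^N)\subseteq\mathbb{R}^N$. Let $v^-\neq v^+$ in $\mathbb{R}^N$ be hyperbolic equilibria of $\dot x=f(x)$, i.e. $f(v^\pm)=0$ and no eigenvalue of the linearizations $f'(v^\pm)$ has zero real part. Call an eigenvalue stable if its real part is negative and unstable if its real part is positive, and call it semisimple if its algebraic and geometric multiplicities coincide. Call a list of complex numbers $\mu_1,\dots,\mu_m$ nonresonant if $$\mu_{j_0}\neq\sum_{j=1}^m n_j\mu_j$$ for all $j_0\in\{1,\dots,m\}$ and all $(n_1,\dots,n_m)\in\mathbb{N}_0^m$ with $n_1+\dots+n_m\ge 2$. Assume that the unstable eigenvalues of $f'(v^-)$ are real, semisimple and nonresonant, and that, separately, the stable eigenvalues of $f'(v^+)$ are real, semisimple and nonresonant. Let $\Gamma:\mathbb{R}\to\mathbb{R}^N$ be a real heteroclinic orbit from $v^-$ to $v^+$, i.e. $\dot\Gamma(t)=f(\Gamma(t))$ for all $t\in\mathbb{R}$, and $\Gamma(t)\to v^\pm$ for $t\to\pm\infty$. Then $\Gamma$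 is not complex entire in time: there is no complex entire function $\mathbb{C}\to\mathbb{C}^N$ which coincides with $\Gamma$ on $\mathbb{R}$. -/

import Mathlib

open Filter Topology

/-- The inclusion of `ℝ^N` into its complexification `ℂ^N`. -/
def complexify {N : ℕ} (x : Fin N → ℝ) : Fin N → ℂ := fun i => (x i : ℂ)

/-- `F : ℂ^N → ℂ^N` is complex entire and restricts to the real vector field `f` on `ℝ^N`. -/
def IsEntireExtension {N : ℕ} (F : (Fin N → ℂ) → (Fin N → ℂ))
    (f : (Fin N → ℝ) → (Fin N → ℝ)) : Prop :=
  Differentiable ℂ F ∧ ∀ x : Fin N → ℝ, F (complexify x) = complexify (f x)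

/-- The linearization `A = F'(v)` at a real point `v`, as an endomorphism of `ℂ^N`. -/
noncomputable def linearization {N : ℕ} (F : (Fin N → ℂ) → (Fin N → ℂ)) (v : Fin N → ℝ) :
    Module.End ℂ (Fin N → ℂ) :=
  (fderiv ℂ F (complexify v) : (Fin N → ℂ) →ₗ[ℂ] (Fin N → ℂ))

/-- The stable eigenvalues: those with negative real part. -/
def stableSpectrum {N : ℕ} (A : Module.End ℂ (Fin N → ℂ)) : Set ℂ :=
  {μ | A.HasEigenvalue μ ∧ μ.re < 0}

/-- The unstable eigenvalues: those with positive real part. -/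
def unstableSpectrum {N : ℕ} (A : Module.End ℂ (Fin N → ℂ)) : Set ℂ :=
  {μ | A.HasEigenvalue μ ∧ 0 < μ.re}

/-- `v` is an equilibrium of `f` whose linearization has no purely imaginary eigenvalue
(zero included). -/
def IsHyperbolicEquilibrium {N : ℕ} (F : (Fin N → ℂ) → (Fin N → ℂ))
    (f : (Fin N → ℝ) → (Fin N → ℝ)) (v : Fin N → ℝ) : Prop :=
  f v = 0 ∧ ∀ μ : ℂ, (linearization F v).HasEigenvalue μ → μ.re ≠ 0

/-- `μ` is a semisimple eigenvalue of `A`: generalized eigenvectors are eigenvectors, that is,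
algebraic and geometric multiplicities coincide. -/
def IsSemisimpleEigenvalue {N : ℕ} (A : Module.End ℂ (Fin N → ℂ)) (μ : ℂ) : Prop :=
  A.HasEigenvalue μ ∧ A.maxGenEigenspace μ = A.eigenspace μ

/-- No element `μ₀` of `S` is a sum `∑ n_μ μ` of elements of `S` with nonnegative integer
coefficients of total order `∑ n_μ ≥ 2`. (Listing an eigenvalue several times, according to
multiplicity, does not change the set of such sums.) -/
def Nonresonant (S : Set ℂ) : Prop :=
  ∀ μ₀ ∈ S, ∀ n : ℂ →₀ ℕ, (n.support : Set ℂ) ⊆ S → 2 ≤ (n.sum fun _ k => k) →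
    μ₀ ≠ n.sum fun μ k => (k : ℂ) * μ

/-- Every element of `S` is a real and semisimple eigenvalue of `A`, and `S` is nonresonant. -/
def RealSemisimpleNonresonant {N : ℕ} (A : Module.End ℂ (Fin N → ℂ)) (S : Set ℂ) : Prop :=
  (∀ μ ∈ S, μ.im = 0) ∧ (∀ μ ∈ S, IsSemisimpleEigenvalue A μ) ∧ Nonresonant S

/-- `Γ : ℝ → ℝ^N` is a global solution of `ẋ = f(x)` which converges to `vm` in backward and to
`vp ≠ vm` in forward real time. -/
def IsHeteroclinicOrbit {N : ℕ} (f : (Fin N → ℝ) → (Fin N → ℝ)) (vm vp : Fin N → ℝ)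
    (Γ : ℝ → (Fin N → ℝ)) : Prop :=
  vm ≠ vp ∧ (∀ t : ℝ, HasDerivAt Γ (f (Γ t)) t) ∧
    Tendsto Γ atBot (𝓝 vm) ∧ Tendsto Γ atTop (𝓝 vp)

/-- The curve `Γ : ℝ → ℝ^N` extends to a complex entire curve `ℂ → ℂ^N`. -/
def IsComplexEntireInTime {N : ℕ} (Γ : ℝ → (Fin N → ℝ)) : Prop :=
  ∃ G : ℂ → (Fin N → ℂ), Differentiable ℂ G ∧ ∀ t : ℝ, G (t : ℂ) = complexify (Γ t)

/-! Suppose that `Γ` has an entire extension `G`. By the identity theorem, `G` solves the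
complexified equation on all of `ℂ` (`hasDerivAt_of_entire_extension`). The point is that `G` must
then be bounded (`exists_norm_le_of_heteroclinic`); by Liouville it is constant, against its two
distinct limits.

Near `v⁻`, on the real axis, `G` agrees up to `O(exp (β t))`, with `β` as large as desired, with a
finite sum `Q` of exponentials of real positive frequencies (`exists_expansion`). Semisimplicity and
nonresonance exclude polynomial factors in `t`. As the frequencies are real, each term has a modulus
that depends on `Re z` only, and `Q` is almost periodic in the imaginary direction.

Once `β` exceeds a Lipschitz constant of the field, Grönwall estimates extend the closeness of `G`
and `Q` from the real axis to a left half-plane, so `G` is bounded there. Time reversal gives a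
bound on a right half-plane, where `v⁺` is approached. For the strip in between, almost periodicity
yields arbitrarily large `n` with `G (T ± n i)` close to `G T`; continuous dependence over a real
time of fixed length then bounds `G` on horizontal segments across the strip at heights `± n`
(`exists_bound_and_recurrence`). The maximum principle on the resulting rectangles bounds `G`
everywhere. -/

/-- Restriction of a complex differentiable curve to the real axis. -/
theorem HasDerivAt.comp_ofReal' {W : Type*} [NormedAddCommGroup W] [NormedSpace ℂ W]
    {G : ℂ → W} {g : W} {s : ℝ} (h : HasDerivAt G g (s : ℂ)) :
    HasDerivAt (fun s : ℝ => G s) g s := by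
  simpa [Function.comp_def] using HasDerivAt.scomp s h Complex.ofRealCLM.hasDerivAt

/-! ### Regularity and Taylor expansion of entire maps in several variables -/

section EntireTaylor

open MeasureTheory

variable {V : Type*} [NormedAddCommGroup V] [NormedSpace ℂ V] [FiniteDimensional ℂ V]
variable {W : Type*} [NormedAddCommGroup W] [NormedSpace ℂ W]

/-- The derivative of an entire map of a finite-dimensional space is bounded on balls. -/
theorem exists_norm_fderiv_le_of_differentiable {F : V → W} (hF : Differentiable ℂ F) (R : ℝ) :
    ∃ C, 0 ≤ C ∧ ∀ x, ‖x‖ ≤ R → ‖fderiv ℂ F x‖ ≤ C := by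
  have : ProperSpace V := FiniteDimensional.proper ℂ V
  obtain ⟨C, hC⟩ := (isCompact_closedBall (0 : V) (R + 1)).exists_bound_of_continuousOn
    hF.continuous.continuousOn
  refine ⟨|C|, abs_nonneg _, fun x hx => ?_⟩
  refine ContinuousLinearMap.opNorm_le_bound _ (abs_nonneg _) fun h => ?_
  rcases eq_or_ne h 0 with rfl | hh
  · simp
  have hh' : 0 < ‖h‖ := norm_pos_iff.2 hh
  have hd : HasDerivAt (fun z : ℂ => x + z • h) h 0 := by
    simpa using ((hasDerivAt_id (0 : ℂ)).smul_const h).const_add x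
  have h1 : HasDerivAt (fun z : ℂ => F (x + z • h)) (fderiv ℂ F x h) 0 := by
    have := (hF (x + (0 : ℂ) • h)).hasFDerivAt.comp_hasDerivAt (0 : ℂ) hd
    simpa [Function.comp_def] using this
  have h2 : Differentiable ℂ (fun z : ℂ => F (x + z • h)) :=
    hF.comp ((differentiable_id.smul_const h).const_add x)
  rw [← h1.deriv]
  -- Cauchy's estimate on the circle of radius `‖h‖⁻¹`, where `z • h` has norm one and `F` is
  -- bounded by `|C|`.
  have := Complex.norm_deriv_le_of_forall_mem_sphere_norm_le (c := 0) (C := |C|) (inv_pos.2 hh')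
    h2.diffContOnCl (fun z hz => (hC _ ?_).trans (le_abs_self C))
  · simpa using this
  · rw [mem_closedBall_zero_iff]
    have hz' : ‖z‖ = ‖h‖⁻¹ := by simpa using hz
    calc ‖x + z • h‖ ≤ ‖x‖ + ‖z • h‖ := norm_add_le _ _
      _ ≤ R + 1 := by rw [norm_smul, hz', inv_mul_cancel₀ hh'.ne']; linarith

/-- Entire maps of a finite-dimensional space are Lipschitz on balls. -/
theorem exists_norm_sub_le_of_differentiable {F : V → W} (hF : Differentiable ℂ F) (R : ℝ) :
    ∃ C, 0 ≤ C ∧ ∀ x y, ‖x‖ ≤ R → ‖y‖ ≤ R → ‖F y - F x‖ ≤ C * ‖y - x‖ := by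
  obtain ⟨C, hC0, hC⟩ := exists_norm_fderiv_le_of_differentiable hF R
  let : NormedSpace ℝ V := NormedSpace.restrictScalars ℝ ℂ V
  refine ⟨C, hC0, fun x y hx hy => ?_⟩
  refine (convex_closedBall (0 : V) R).norm_image_sub_le_of_norm_fderiv_le (𝕜 := ℂ)
    (fun z _ => hF z) (fun z hz => hC z (by simpa using hz)) (by simpa using hx) (by simpa using hy)

variable [FiniteDimensional ℂ W]

/-- The directional derivatives of an entire map are entire. -/
theorem differentiable_fderiv_apply {F : V → W} (hF : Differentiable ℂ F) (h : V) :
    Differentiable ℂ (fun x => fderiv ℂ F x h) := by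
  have : ProperSpace V := FiniteDimensional.proper ℂ V
  have : ProperSpace (V →L[ℂ] W) := FiniteDimensional.proper ℂ _
  have : SecondCountableTopology (V →L[ℂ] W) := secondCountable_of_proper
  have : CompleteSpace W := FiniteDimensional.complete ℂ W
  let : MeasurableSpace V := borel V
  have : BorelSpace V := ⟨rfl⟩
  set g : ℝ → V := fun θ => circleMap 0 1 θ • h with hg
  have hgc : Continuous g := (continuous_circleMap 0 1).smul continuous_const
  set c : ℝ → ℂ := fun θ => deriv (circleMap 0 1) θ * (1 / (circleMap 0 1 θ - 0) ^ 2) with hc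
  have hcc : Continuous c := by
    simp only [hc, deriv_circleMap, sub_zero]
    refine ((continuous_circleMap 0 1).mul continuous_const).mul
      (continuous_const.div ((continuous_circleMap 0 1).pow 2) fun θ => ?_)
    exact pow_ne_zero 2 (circleMap_ne_center one_ne_zero)
  have hcn : ∀ θ, ‖c θ‖ = 1 := by
    intro θ
    simp [hc, deriv_circleMap]
  have hgn : ∀ θ, ‖g θ‖ = ‖h‖ := by
    intro θ
    simp [hg, norm_smul]
  -- Cauchy's formula writes the directional derivative as an integral of translates of `F`, which
  -- may be differentiated under the integral sign: only measurability and local boundedness of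
  -- `fderiv` are needed, not its continuity.
  have key : (fun x => fderiv ℂ F x h) = fun x =>
      (2 * (Real.pi : ℂ) * Complex.I)⁻¹ • ∫ θ in Set.Ioc 0 (2 * Real.pi), c θ • F (x + g θ) := by
    funext x
    have hd : HasDerivAt (fun z : ℂ => x + z • h) h 0 := by
      simpa using ((hasDerivAt_id (0 : ℂ)).smul_const h).const_add x
    have h1 : HasDerivAt (fun z : ℂ => F (x + z • h)) (fderiv ℂ F x h) 0 := by
      have := (hF (x + (0 : ℂ) • h)).hasFDerivAt.comp_hasDerivAt (0 : ℂ) hd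
      simpa [Function.comp_def] using this
    have h2 : Differentiable ℂ (fun z : ℂ => F (x + z • h)) :=
      hF.comp ((differentiable_id.smul_const h).const_add x)
    have h3 := (h2.differentiableOn (s := Metric.closedBall 0 1)).deriv_eq_smul_circleIntegral
      zero_lt_one
    rw [h1.deriv, circleIntegral, intervalIntegral.integral_of_le Real.two_pi_pos.le] at h3
    have h4 : (2 * (Real.pi : ℂ) * Complex.I) ≠ 0 := Complex.two_pi_I_ne_zero
    rw [eq_inv_smul_iff₀ h4, ← h3]
    simp only [hc, hg, mul_smul]
  rw [key]
  intro x₀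
  refine DifferentiableAt.const_smul ?_ _
  obtain ⟨C, hC0, hC⟩ := exists_norm_fderiv_le_of_differentiable hF (‖x₀‖ + 1 + ‖h‖)
  refine (hasFDerivAt_integral_of_dominated_of_fderiv_le (𝕜 := ℂ) (s := Metric.ball x₀ 1)
    (F := fun x θ => c θ • F (x + g θ)) (F' := fun x θ => c θ • fderiv ℂ F (x + g θ))
    (bound := fun _ => C) (Metric.ball_mem_nhds _ one_pos) ?_ ?_ ?_ ?_ ?_ ?_).differentiableAt
  · exact Eventually.of_forall fun x =>
      (hcc.smul (hF.continuous.comp (continuous_const.add hgc))).aestronglyMeasurable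
  · exact ((hcc.smul (hF.continuous.comp (continuous_const.add hgc))).integrableOn_Icc).mono_set
      Set.Ioc_subset_Icc_self
  · refine AEStronglyMeasurable.smul hcc.aestronglyMeasurable ?_
    exact ((measurable_fderiv ℂ F).comp
      (continuous_const.add hgc).measurable).aestronglyMeasurable
  · refine Eventually.of_forall fun θ x hx => ?_
    rw [norm_smul, hcn, one_mul]
    refine hC _ ?_
    have h1 : ‖x - x₀‖ < 1 := by simpa [dist_eq_norm] using hx
    have h2 : ‖x‖ ≤ ‖x - x₀‖ + ‖x₀‖ := by simpa using norm_add_le (x - x₀) x₀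
    have h3 := norm_add_le x (g θ)
    rw [hgn] at h3
    linarith
  · exact integrableOn_const measure_Ioc_lt_top.ne (by simp)
  · refine Eventually.of_forall fun θ x _ => ?_
    have h1 : HasFDerivAt (fun x => x + g θ) (ContinuousLinearMap.id ℂ V) x :=
      (hasFDerivAt_id x).add_const _
    have := ((hF (x + g θ)).hasFDerivAt.comp x h1).const_smul (c θ)
    rw [ContinuousLinearMap.comp_id] at this
    exact this

/-- The derivative of an entire map is entire. -/
theorem differentiable_fderiv {F : V → W} (hF : Differentiable ℂ F) :
    Differentiable ℂ (fderiv ℂ F) := by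
  let e₁ : V ≃L[ℂ] (Fin (Module.finrank ℂ V) → ℂ) :=
    ContinuousLinearEquiv.ofFinrankEq (by simp)
  let e₂ := (e₁.arrowCongr (ContinuousLinearEquiv.refl ℂ W)).trans
    (ContinuousLinearEquiv.piRing (𝕜 := ℂ) (Fin (Module.finrank ℂ V)))
  rw [← e₂.comp_differentiable_iff]
  exact differentiable_pi.2 fun i => differentiable_fderiv_apply hF _

end EntireTaylor

/-- The sum of the homogeneous polynomials `x ↦ p k (x, …, x)` of degrees `m ≤ k < M`. -/
noncomputable def multilinearSum {V W : Type*} [NormedAddCommGroup V] [NormedSpace ℂ V]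
    [NormedAddCommGroup W] [NormedSpace ℂ W]
    (p : ∀ k : ℕ, ContinuousMultilinearMap ℂ (fun _ : Fin k => V) W) (m M : ℕ) (x : V) : W :=
  ∑ k ∈ Finset.Ico m M, p k fun _ => x

/-- Taylor expansion of an entire map. -/
theorem exists_taylor_of_differentiable.{u} {V : Type u} [NormedAddCommGroup V] [NormedSpace ℂ V]
    [FiniteDimensional ℂ V] (v : V) (M : ℕ) :
    ∀ {W : Type u} [NormedAddCommGroup W] [NormedSpace ℂ W] [FiniteDimensional ℂ W]
      {F : V → W}, Differentiable ℂ F →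
      ∃ p : ∀ k : ℕ, ContinuousMultilinearMap ℂ (fun _ : Fin k => V) W,
        (0 < M → ∀ m, p 0 m = F v) ∧ (1 < M → ∀ m, p 1 m = fderiv ℂ F v (m 0)) ∧
        ∃ C, 0 ≤ C ∧ ∀ y, ‖y‖ ≤ 1 → ‖F (v + y) - multilinearSum p 0 M y‖ ≤ C * ‖y‖ ^ M := by
  induction M with
  | zero =>
    intro W _ _ _ F hF
    have : ProperSpace V := FiniteDimensional.proper ℂ V
    obtain ⟨C, hC⟩ := (isCompact_closedBall v 1).exists_bound_of_continuousOn
      hF.continuous.continuousOn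
    refine ⟨fun _ => 0, by simp, by simp, |C|, abs_nonneg _, fun y hy => ?_⟩
    have := hC (v + y) (by simpa [dist_eq_norm] using hy)
    simpa [multilinearSum] using this.trans (le_abs_self C)
  | succ M ih =>
    intro W _ _ _ F hF
    -- The expansion of `fderiv ℂ F` to order `M` is integrated along the segment from `v` to `v +
    -- y`, which gains one power of `‖y‖`. The target changes to `V →L[ℂ] W`, hence the
    -- quantification over `W` inside the induction. The factors `1 / (k + 1)` below are those of a
    -- primitive of `s ^ k`.
    obtain ⟨p, hp0, -, C, hC0, hC⟩ := ih (differentiable_fderiv hF)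
    let q : ∀ k : ℕ, ContinuousMultilinearMap ℂ (fun _ : Fin k => V) W := fun k =>
      match k with
      | 0 => ContinuousMultilinearMap.constOfIsEmpty ℂ _ (F v)
      | k + 1 => ((k : ℂ) + 1)⁻¹ • (p k).uncurryRight
    refine ⟨q, fun _ _ => rfl, fun hM m => ?_, C, hC0, fun y hy => ?_⟩
    · simp [q, hp0 (by omega)]
    set φ : ℝ → W := fun s => F (v + (s : ℂ) • y) - multilinearSum q 0 (M + 1) ((s : ℂ) • y)
      with hφ
    have hq : ∀ x : V, multilinearSum q 0 (M + 1) x =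
        F v + ∑ k ∈ Finset.range M, ((k : ℂ) + 1)⁻¹ • (p k (fun _ => x)) x := by
      intro x
      simp only [multilinearSum]
      rw [← Finset.range_eq_Ico, Finset.sum_range_succ']
      rw [add_comm]
      congr 1
    have hderiv : ∀ s : ℝ, HasDerivAt φ
        ((fderiv ℂ F (v + (s : ℂ) • y) - multilinearSum p 0 M ((s : ℂ) • y)) y) s := by
      intro s
      have hd : HasDerivAt (fun z : ℂ => v + z • y) y (s : ℂ) := by
        simpa using ((hasDerivAt_id (s : ℂ)).smul_const y).const_add v
      have h1 := ((hF (v + (s : ℂ) • y)).hasFDerivAt.comp_hasDerivAt (s : ℂ) hd)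
      have h2 : HasDerivAt (fun z : ℂ => multilinearSum q 0 (M + 1) (z • y))
          ((multilinearSum p 0 M ((s : ℂ) • y)) y) (s : ℂ) := by
        have e1 : (fun z : ℂ => multilinearSum q 0 (M + 1) (z • y)) = fun z : ℂ =>
            F v + ∑ k ∈ Finset.range M,
              (z ^ (k + 1)) • (((k : ℂ) + 1)⁻¹ • (p k (fun _ => y)) y) := by
          funext z
          rw [hq]
          congr 1
          refine Finset.sum_congr rfl fun k _ => ?_
          have : p k (fun _ => z • y) = z ^ k • p k (fun _ => y) := by
            simpa using (p k).map_smul_univ (fun _ => z) (fun _ => y)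
          rw [this, smul_apply, map_smul, smul_smul, smul_smul, smul_smul]
          ring_nf
        have e2 : (multilinearSum p 0 M ((s : ℂ) • y)) y = ∑ k ∈ Finset.range M,
            (((k : ℂ) + 1) * (s : ℂ) ^ k) • (((k : ℂ) + 1)⁻¹ • (p k (fun _ => y)) y) := by
          simp only [multilinearSum]
          rw [← Finset.range_eq_Ico, sum_apply]
          refine Finset.sum_congr rfl fun k _ => ?_
          have : p k (fun _ => (s : ℂ) • y) = (s : ℂ) ^ k • p k (fun _ => y) := by
            simpa using (p k).map_smul_univ (fun _ => (s : ℂ)) (fun _ => y)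
          have h0 : (k : ℂ) + 1 ≠ 0 := Nat.cast_add_one_ne_zero k
          rw [this, smul_apply, smul_smul]
          congr 1
          field_simp
        rw [e1, e2]
        refine HasDerivAt.const_add _ (HasDerivAt.fun_sum fun k _ => ?_)
        have := (hasDerivAt_pow (k + 1) (s : ℂ)).smul_const
          (((k : ℂ) + 1)⁻¹ • (p k (fun _ => y)) y)
        simpa using this
      exact (h1.sub h2).comp_ofReal'
    have hbound : ∀ s ∈ Set.Ico (0 : ℝ) 1,
        ‖(fderiv ℂ F (v + (s : ℂ) • y) - multilinearSum p 0 M ((s : ℂ) • y)) y‖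
          ≤ C * ‖y‖ ^ (M + 1) := by
      intro s hs
      have hn : ‖(s : ℂ) • y‖ ≤ ‖y‖ := by
        rw [norm_smul, Complex.norm_real, Real.norm_of_nonneg hs.1]
        exact mul_le_of_le_one_left (norm_nonneg _) hs.2.le
      refine (ContinuousLinearMap.le_opNorm _ _).trans ?_
      rw [pow_succ, ← mul_assoc]
      refine mul_le_mul_of_nonneg_right ((hC _ (hn.trans hy)).trans ?_) (norm_nonneg _)
      gcongr
    have h0 : φ 0 = 0 := by
      simp only [hφ, hq]
      simp
    have := norm_image_sub_le_of_norm_deriv_le_segment' (f := φ) (a := 0) (b := 1)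
      (fun s _ => (hderiv s).hasDerivWithinAt) hbound 1 (by simp)
    rw [h0] at this
    simpa [hφ] using this

/-! ### Scalar linear equations with exponentially small forcing -/

section LinearODE

open Real

variable {V : Type*} [NormedAddCommGroup V] [NormedSpace ℂ V]

/-- Comparison with the primitive of the bound. Both signs of `κ` occur: negative ones in the
backward estimate for unstable equations. -/
theorem norm_sub_le_of_norm_deriv_le_exp {v v' : ℝ → V} {C κ T : ℝ} (hκ : κ ≠ 0)
    (hv : ∀ t ≤ T, HasDerivAt v (v' t) t) (hb : ∀ t ≤ T, ‖v' t‖ ≤ C * exp (κ * t))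
    {s t : ℝ} (hst : s ≤ t) (ht : t ≤ T) :
    ‖v t - v s‖ ≤ C / κ * (exp (κ * t) - exp (κ * s)) := by
  have hB : ∀ x, HasDerivAt (fun x => C / κ * (exp (κ * x) - exp (κ * s))) (C * exp (κ * x)) x := by
    intro x
    have := ((((hasDerivAt_id x).const_mul κ).exp).sub_const (exp (κ * s))).const_mul (C / κ)
    refine this.congr_deriv ?_
    simp only [id]
    field_simp
  refine image_norm_le_of_norm_deriv_right_le_deriv_boundary (f := fun x => v x - v s) (f' := v')
    (a := s) (b := t) (fun x hx => ?_) (fun x hx => ?_) (by simp) hB (fun x hx => ?_)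
    ⟨hst, le_rfl⟩
  · exact ((hv x (hx.2.trans ht)).sub_const _).continuousAt.continuousWithinAt
  · exact ((hv x (hx.2.le.trans ht)).sub_const _).hasDerivWithinAt
  · exact hb x (hx.2.le.trans ht)

theorem norm_sub_le_of_tendsto_atBot {v v' : ℝ → V} {C κ T : ℝ} {L : V} (hκ : 0 < κ)
    (hv : ∀ t ≤ T, HasDerivAt v (v' t) t) (hb : ∀ t ≤ T, ‖v' t‖ ≤ C * exp (κ * t))
    (hL : Tendsto v atBot (𝓝 L)) {t : ℝ} (ht : t ≤ T) :
    ‖v t - L‖ ≤ C / κ * exp (κ * t) := by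
  have hC : 0 ≤ C := nonneg_of_mul_nonneg_left ((norm_nonneg _).trans (hb T le_rfl)) (exp_pos _)
  refine le_of_tendsto ((tendsto_const_nhds.sub hL).norm) ?_
  filter_upwards [eventually_le_atBot t] with s hs
  refine (norm_sub_le_of_norm_deriv_le_exp hκ.ne' hv hb hs ht).trans ?_
  have := exp_pos (κ * s)
  exact mul_le_mul_of_nonneg_left (by linarith) (by positivity)

theorem exists_tendsto_atBot_of_norm_deriv_le_exp [CompleteSpace V] {v v' : ℝ → V} {C κ T : ℝ}
    (hκ : 0 < κ) (hv : ∀ t ≤ T, HasDerivAt v (v' t) t)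
    (hb : ∀ t ≤ T, ‖v' t‖ ≤ C * exp (κ * t)) : ∃ L, Tendsto v atBot (𝓝 L) := by
  have hC : 0 ≤ C := nonneg_of_mul_nonneg_left ((norm_nonneg _).trans (hb T le_rfl)) (exp_pos _)
  have hlim : Tendsto (fun t : ℝ => C / κ * exp (κ * t)) atBot (𝓝 0) := by
    have := (tendsto_exp_atBot.comp (tendsto_id.const_mul_atBot hκ)).const_mul (C / κ)
    simpa using this
  refine cauchy_map_iff_exists_tendsto.1 ?_
  rw [Metric.cauchy_iff]
  refine ⟨inferInstance, fun ε hε => ?_⟩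
  obtain ⟨S, hS⟩ := (((hlim.eventually (gt_mem_nhds hε)).and
    (eventually_le_atBot T))).exists
  refine ⟨v '' Set.Iic S, image_mem_map (Iic_mem_atBot S), ?_⟩
  have key : ∀ s t, s ≤ t → t ≤ S → ‖v t - v s‖ < ε := by
    intro s t hst htS
    refine (norm_sub_le_of_norm_deriv_le_exp hκ.ne' hv hb hst (htS.trans hS.2)).trans_lt ?_
    refine lt_of_le_of_lt ?_ hS.1
    have h1 := exp_pos (κ * s)
    have h2 : exp (κ * t) ≤ exp (κ * S) := by gcongr
    exact mul_le_mul_of_nonneg_left (by linarith) (by positivity)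
  rintro _ ⟨s, hs, rfl⟩ _ ⟨t, ht, rfl⟩
  rcases le_total s t with h | h
  · rw [dist_comm, dist_eq_norm]
    exact key s t h ht
  · rw [dist_eq_norm]
    exact key t s h hs

theorem norm_cexp_neg_mul (μ : ℂ) (t : ℝ) : ‖Complex.exp (-μ * t)‖ = exp (-μ.re * t) := by
  simp [Complex.norm_exp]

theorem norm_cexp_mul (μ : ℂ) (t : ℝ) : ‖Complex.exp (μ * t)‖ = exp (μ.re * t) := by
  simp [Complex.norm_exp]

theorem hasDerivAt_cexp_neg_smul {u : ℝ → V} {μ : ℂ} {r : V} {t : ℝ}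
    (hu : HasDerivAt u (μ • u t + r) t) :
    HasDerivAt (fun t : ℝ => Complex.exp (-μ * t) • u t) (Complex.exp (-μ * t) • r) t := by
  have h1 : HasDerivAt (fun z : ℂ => Complex.exp (-μ * z)) (Complex.exp (-μ * t) * -μ) (t : ℂ) := by
    simpa using ((hasDerivAt_id (t : ℂ)).const_mul (-μ)).cexp
  have := h1.comp_ofReal'.fun_smul hu
  convert this using 1
  rw [smul_add, smul_smul]
  module

theorem norm_cexp_neg_smul_le {μ : ℂ} {ρ γ t : ℝ} {r : V} (h : ‖r‖ ≤ ρ * exp (γ * t)) :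
    ‖Complex.exp (-μ * t) • r‖ ≤ ρ * exp ((γ - μ.re) * t) := by
  rw [norm_smul, norm_cexp_neg_mul]
  calc exp (-μ.re * t) * ‖r‖ ≤ exp (-μ.re * t) * (ρ * exp (γ * t)) := by gcongr
    _ = ρ * (exp (-μ.re * t) * exp (γ * t)) := by ring
    _ = ρ * exp ((γ - μ.re) * t) := by rw [← exp_add]; ring_nf

theorem eq_cexp_smul_cexp_neg_smul (μ : ℂ) (t : ℝ) (x : V) :
    x = Complex.exp (μ * t) • (Complex.exp (-μ * t) • x) := by
  rw [smul_smul, ← Complex.exp_add]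
  simp

/-- Bounded solutions of a stable scalar equation are as small as the inhomogeneity. -/
theorem norm_le_of_stable {u r : ℝ → V} {μ : ℂ} {ρ γ T M : ℝ} (hμ : μ.re < 0) (hγ : 0 ≤ γ)
    (hu : ∀ t ≤ T, HasDerivAt u (μ • u t + r t) t) (hr : ∀ t ≤ T, ‖r t‖ ≤ ρ * exp (γ * t))
    (hM : ∀ t ≤ T, ‖u t‖ ≤ M) {t : ℝ} (ht : t ≤ T) :
    ‖u t‖ ≤ ρ / (γ - μ.re) * exp (γ * t) := by
  -- A bounded solution has no homogeneous part: after multiplication by the integrating factor it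
  -- vanishes at `-∞`.
  have hlim : Tendsto (fun t : ℝ => Complex.exp (-μ * t) • u t) atBot (𝓝 0) := by
    have h1 : Tendsto (fun t : ℝ => exp (-μ.re * t) * M) atBot (𝓝 0) := by
      have := (tendsto_exp_atBot.comp
        (tendsto_id.const_mul_atBot (neg_pos.2 hμ))).mul_const M
      simpa using this
    refine squeeze_zero_norm' ?_ h1
    filter_upwards [eventually_le_atBot T] with s hs
    rw [norm_smul, norm_cexp_neg_mul]
    exact mul_le_mul_of_nonneg_left (hM s hs) (exp_pos _).le
  have := norm_sub_le_of_tendsto_atBot (κ := γ - μ.re) (by linarith)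
    (fun t ht => hasDerivAt_cexp_neg_smul (hu t ht))
    (fun t ht => norm_cexp_neg_smul_le (hr t ht)) hlim ht
  rw [sub_zero] at this
  rw [eq_cexp_smul_cexp_neg_smul μ t (u t), norm_smul, norm_cexp_mul]
  calc exp (μ.re * t) * ‖Complex.exp (-μ * t) • u t‖
      ≤ exp (μ.re * t) * (ρ / (γ - μ.re) * exp ((γ - μ.re) * t)) := by gcongr
    _ = ρ / (γ - μ.re) * (exp (μ.re * t) * exp ((γ - μ.re) * t)) := by ring
    _ = _ := by rw [← exp_add]; ring_nf

/-- Backward estimate for an unstable scalar equation. -/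
theorem norm_le_of_unstable {u r : ℝ → V} {μ : ℂ} {ρ γ T : ℝ} (hμ : γ < μ.re)
    (hu : ∀ t ≤ T, HasDerivAt u (μ • u t + r t) t) (hr : ∀ t ≤ T, ‖r t‖ ≤ ρ * exp (γ * t))
    {t : ℝ} (ht : t ≤ T) :
    ‖u t‖ ≤ exp (μ.re * (t - T)) * ‖u T‖ + ρ / (μ.re - γ) * exp (γ * t) := by
  have hρ : 0 ≤ ρ := nonneg_of_mul_nonneg_left ((norm_nonneg _).trans (hr T le_rfl)) (exp_pos _)
  have h1 := norm_sub_le_of_norm_deriv_le_exp (κ := γ - μ.re) (by linarith)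
    (fun t ht => hasDerivAt_cexp_neg_smul (hu t ht))
    (fun t ht => norm_cexp_neg_smul_le (hr t ht)) ht le_rfl
  have h2 : ρ / (γ - μ.re) * (exp ((γ - μ.re) * T) - exp ((γ - μ.re) * t))
      ≤ ρ / (μ.re - γ) * exp ((γ - μ.re) * t) := by
    have e : ρ / (γ - μ.re) = -(ρ / (μ.re - γ)) := by rw [← div_neg]; ring_nf
    have h3 : 0 ≤ ρ / (μ.re - γ) := div_nonneg hρ (by linarith)
    have h4 := exp_pos ((γ - μ.re) * T)
    rw [e]
    nlinarith
  have h3 : ‖Complex.exp (-μ * t) • u t‖ ≤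
      exp (-μ.re * T) * ‖u T‖ + ρ / (μ.re - γ) * exp ((γ - μ.re) * t) := by
    have h4 := norm_sub_norm_le (Complex.exp (-μ * t) • u t) (Complex.exp (-μ * T) • u T)
    rw [norm_sub_rev] at h4
    have h5 : ‖Complex.exp (-μ * T) • u T‖ = exp (-μ.re * T) * ‖u T‖ := by
      rw [norm_smul, norm_cexp_neg_mul]
    linarith
  rw [eq_cexp_smul_cexp_neg_smul μ t (u t), norm_smul, norm_cexp_mul]
  calc exp (μ.re * t) * ‖Complex.exp (-μ * t) • u t‖
      ≤ exp (μ.re * t) *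
        (exp (-μ.re * T) * ‖u T‖ + ρ / (μ.re - γ) * exp ((γ - μ.re) * t)) := by gcongr
    _ = (exp (μ.re * t) * exp (-μ.re * T)) * ‖u T‖ +
        ρ / (μ.re - γ) * (exp (μ.re * t) * exp ((γ - μ.re) * t)) := by ring
    _ = _ := by rw [← exp_add, ← exp_add]; ring_nf

/-- Solutions of an unstable scalar equation with exponentially small inhomogeneity are
exponentials up to an exponentially small error. -/
theorem exists_norm_sub_cexp_le [CompleteSpace V] {u r : ℝ → V} {μ : ℂ} {ρ γ γ' T : ℝ}
    (hγ : γ' < γ) (hT : T ≤ 0)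
    (hu : ∀ t ≤ T, HasDerivAt u (μ • u t + r t) t) (hr : ∀ t ≤ T, ‖r t‖ ≤ ρ * exp (γ * t)) :
    ∃ b : V, (∀ L : V →L[ℂ] V, (∀ t, L (u t) = 0) → L b = 0) ∧
      ∃ C, ∀ t ≤ T, ‖u t - Complex.exp (μ * t) • b‖ ≤ C * exp (γ' * t) := by
  have hρ : 0 ≤ ρ := nonneg_of_mul_nonneg_left ((norm_nonneg _).trans (hr T le_rfl)) (exp_pos _)
  have hexp : ∀ t ≤ T, exp (γ * t) ≤ exp (γ' * t) := fun t ht =>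
    exp_le_exp.2 (by nlinarith)
  -- If `Re μ < γ`, then `b` is the limit of `exp (-μ t) u t` at `-∞`. Otherwise the exponential is
  -- itself negligible and `b = 0`; the loss from `γ` to `γ'` avoids a factor `t` when `Re μ = γ`.
  rcases lt_or_ge μ.re γ with hμ | hμ
  · have hv : ∀ t ≤ T, _ := fun t ht => hasDerivAt_cexp_neg_smul (hu t ht)
    have hb : ∀ t ≤ T, _ := fun t ht => norm_cexp_neg_smul_le (μ := μ) (hr t ht)
    obtain ⟨b, hL⟩ := exists_tendsto_atBot_of_norm_deriv_le_exp (sub_pos.2 hμ) hv hb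
    refine ⟨b, fun L h => ?_, ρ / (γ - μ.re), fun t ht => ?_⟩
    · have h1 := (L.continuous.tendsto b).comp hL
      have h2 : (L ∘ fun t : ℝ => Complex.exp (-μ * t) • u t) = fun _ => 0 := by
        funext t
        simp [h t]
      rw [h2] at h1
      exact tendsto_nhds_unique h1 tendsto_const_nhds
    have h1 := norm_sub_le_of_tendsto_atBot (sub_pos.2 hμ) hv hb hL ht
    have h0 : 0 ≤ ρ / (γ - μ.re) := div_nonneg hρ (by linarith)
    calc ‖u t - Complex.exp (μ * t) • b‖
        = exp (μ.re * t) * ‖Complex.exp (-μ * t) • u t - b‖ := by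
          rw [← norm_cexp_mul, ← norm_smul, smul_sub, ← eq_cexp_smul_cexp_neg_smul]
      _ ≤ exp (μ.re * t) * (ρ / (γ - μ.re) * exp ((γ - μ.re) * t)) := by gcongr
      _ = ρ / (γ - μ.re) * (exp (μ.re * t) * exp ((γ - μ.re) * t)) := by ring
      _ = ρ / (γ - μ.re) * exp (γ * t) := by rw [← exp_add]; ring_nf
      _ ≤ _ := mul_le_mul_of_nonneg_left (hexp t ht) h0
  · refine ⟨0, fun L _ => map_zero L, exp (-μ.re * T) * ‖u T‖ + ρ / (μ.re - γ'), fun t ht => ?_⟩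
    have h1 := norm_le_of_unstable (hγ.trans_le hμ) hu
      (fun t ht => (hr t ht).trans (mul_le_mul_of_nonneg_left (hexp t ht) hρ)) ht
    have h2 : exp (μ.re * (t - T)) ≤ exp (-μ.re * T) * exp (γ' * t) := by
      rw [← exp_add]
      exact exp_le_exp.2 (by nlinarith)
    have h3 := mul_le_mul_of_nonneg_right h2 (norm_nonneg (u T))
    rw [smul_zero, sub_zero]
    linarith

end LinearODE

/-! ### Spectral projections -/

section Spectral

open Real Polynomial

variable {V : Type*} [NormedAddCommGroup V] [NormedSpace ℂ V] [FiniteDimensional ℂ V]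

/-- Spectral projections, as polynomials in the endomorphism. -/
theorem Module.End.exists_spectral_projections (A : Module.End ℂ V) :
    ∃ (s : Finset ℂ) (P : ℂ → Module.End ℂ V), (∀ μ ∈ s, A.HasEigenvalue μ) ∧
      ∑ μ ∈ s, P μ = 1 ∧
      ∀ μ ∈ s, (∃ k : ℕ, (A - algebraMap ℂ _ μ) ^ k * P μ = 0) ∧ A * P μ = P μ * A := by
  classical
  set p := A.charpoly with hp
  set s := p.roots.toFinset with hs
  set q : ℂ → ℂ[X] := fun μ => (X - C μ) ^ p.rootMultiplicity μ with hq
  have hprod : ∏ μ ∈ s, q μ = p := by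
    rw [hs, hq, ← prod_multiset_root_eq_finset_root]
    exact ((IsAlgClosed.splits p).eq_prod_roots_of_monic A.charpoly_monic).symm
  have h0 : aeval A p = 0 := A.aeval_self_charpoly
  have hcop : Pairwise (Function.onFun IsCoprime fun i : s => q i) := by
    intro i j hij
    exact (pairwise_coprime_X_sub_C Subtype.val_injective hij).pow
  have heig : ∀ μ ∈ s, A.HasEigenvalue μ := fun μ hμ => by
    rw [Module.End.hasEigenvalue_iff_isRoot_charpoly]
    rw [hs, Multiset.mem_toFinset] at hμ
    exact isRoot_of_mem_roots hμ
  -- Without roots the characteristic polynomial is `1`, so `1 = 0` in the endomorphism ring.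
  -- Otherwise a Bézout identity for the cofactors of the coprime powers `q μ` gives the
  -- projections.
  rcases s.eq_empty_or_nonempty with he | hne
  · refine ⟨s, fun _ => 0, heig, ?_, by simp [he]⟩
    rw [he, Finset.prod_empty] at hprod
    rw [← hprod, map_one] at h0
    simp [h0]
  · obtain ⟨c, hc⟩ := (exists_sum_eq_one_iff_pairwise_coprime (s := q) hne).2 hcop
    refine ⟨s, fun μ => aeval A (c μ * ∏ j ∈ s \ {μ}, q j), heig, ?_, fun μ hμ => ⟨?_, ?_⟩⟩
    · rw [← map_sum, hc, map_one]
    · refine ⟨p.rootMultiplicity μ, ?_⟩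
      have h1 : (A - algebraMap ℂ _ μ) ^ p.rootMultiplicity μ = aeval A (q μ) := by
        simp [hq]
      have h2 : q μ * (c μ * ∏ j ∈ s \ {μ}, q j) = c μ * p := by
        rw [← hprod, ← Finset.mul_prod_erase s q hμ, Finset.sdiff_singleton_eq_erase]
        ring
      rw [h1, ← map_mul, h2, map_mul, h0, mul_zero]
    · have := (Commute.all (X : ℂ[X]) (c μ * ∏ j ∈ s \ {μ}, q j)).map (aeval A)
      simpa using this.eq

/-- Every eigenvalue is off the imaginary axis and the unstable ones are semisimple. -/
structure IsUnstablySemisimple (A : V →L[ℂ] V) : Prop where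
  re_ne_zero : ∀ μ, Module.End.HasEigenvalue (A : V →ₗ[ℂ] V) μ → μ.re ≠ 0
  semisimple : ∀ μ, Module.End.HasEigenvalue (A : V →ₗ[ℂ] V) μ → 0 < μ.re →
    Module.End.maxGenEigenspace (A : V →ₗ[ℂ] V) μ = Module.End.eigenspace (A : V →ₗ[ℂ] V) μ

/-- On the unstable components semisimplicity turns `A` into a scalar, so that scalar estimates
apply. On the stable ones only nilpotency of `A - μ` is available, and it suffices. -/
theorem IsUnstablySemisimple.exists_projections {A : V →L[ℂ] V} (hA : IsUnstablySemisimple A) :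
    ∃ (s : Finset ℂ) (P : ℂ → V →L[ℂ] V),
      (∀ μ ∈ s, Module.End.HasEigenvalue (A : V →ₗ[ℂ] V) μ) ∧ (∀ x, ∑ μ ∈ s, P μ x = x) ∧
      ∀ μ ∈ s, (∀ x, A (P μ x) = P μ (A x)) ∧
        (∃ k : ℕ, ∀ x, ((A - μ • ContinuousLinearMap.id ℂ V) ^ k) (P μ x) = 0) ∧
        (0 < μ.re → ∀ x, A (P μ x) = μ • P μ x) := by
  obtain ⟨s, P, heig, hsum, hP⟩ := Module.End.exists_spectral_projections (A : V →ₗ[ℂ] V)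
  refine ⟨s, fun μ => LinearMap.toContinuousLinearMap (P μ), heig, fun x => ?_, fun μ hμ => ?_⟩
  · simpa using congrArg (fun f : Module.End ℂ V => f x) hsum
  · obtain ⟨⟨k, hk⟩, hcomm⟩ := hP μ hμ
    have hpow : ∀ (k : ℕ) (x : V), ((A - μ • ContinuousLinearMap.id ℂ V) ^ k) x =
        (((A : V →ₗ[ℂ] V) - algebraMap ℂ (Module.End ℂ V) μ : Module.End ℂ V) ^ k) x := by
      intro k
      induction k with
      | zero => simp
      | succ k ih =>
        intro x
        rw [pow_succ, pow_succ]
        simp only [mul_apply_eq_comp, Module.End.mul_apply, ih]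
        congr 1
    have hk' : ∀ x, (((A : V →ₗ[ℂ] V) - algebraMap ℂ (Module.End ℂ V) μ : Module.End ℂ V) ^ k) (P μ x) = 0 := fun x =>
      congrArg (fun f : Module.End ℂ V => f x) hk
    refine ⟨fun x => congrArg (fun f : Module.End ℂ V => f x) hcomm,
      ⟨k, fun x => (hpow k _).trans (hk' x)⟩, fun hre x => ?_⟩
    have h1 : P μ x ∈ Module.End.maxGenEigenspace (A : V →ₗ[ℂ] V) μ := by
      rw [Module.End.mem_maxGenEigenspace]
      exact ⟨k, hk' x⟩
    rw [hA.semisimple μ (heig μ hμ) hre, Module.End.mem_eigenspace_iff] at h1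
    exact h1

end Spectral

/-! ### Bounded backward solutions of linear systems, and exponential convergence -/

section LinearSystem

open Real

variable {V : Type*} [NormedAddCommGroup V] [NormedSpace ℂ V]

/-- Induction on the order of nilpotency: `B y` solves an equation of the same type with order one
less, so `B y + r` can serve as the forcing of the scalar equation with rate `μ`. As `γ ≥ 0`,
division by `γ - Re μ ≥ -Re μ` keeps the constant independent of `γ`. -/
theorem exists_norm_le_of_stable_generalized (A : V →L[ℂ] V) {μ : ℂ} (hμ : μ.re < 0) (k : ℕ) :
    ∃ C, 0 ≤ C ∧ ∀ (y r : ℝ → V) (ρ γ T M : ℝ), 0 ≤ γ →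
      (∀ t ≤ T, HasDerivAt y (A (y t) + r t) t) → (∀ t ≤ T, ‖r t‖ ≤ ρ * exp (γ * t)) →
      (∀ t ≤ T, ‖y t‖ ≤ M) →
      (∀ t, ((A - μ • ContinuousLinearMap.id ℂ V) ^ k) (y t) = 0) →
      ∀ t ≤ T, ‖y t‖ ≤ C * ρ * exp (γ * t) := by
  set B := A - μ • ContinuousLinearMap.id ℂ V with hB
  have hBx : ∀ x, A x = μ • x + B x := by
    intro x
    simp [hB]
  induction k with
  | zero =>
    refine ⟨0, le_rfl, fun y r ρ γ T M _ _ _ _ h0 t _ => ?_⟩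
    have : y t = 0 := by simpa using h0 t
    simp [this]
  | succ k ih =>
    obtain ⟨C, hC0, hC⟩ := ih
    refine ⟨(C * ‖B‖ + 1) / -μ.re, div_nonneg (by positivity) (by linarith),
      fun y r ρ γ T M hγ hy hr hM h0 t ht => ?_⟩
    have hρ : 0 ≤ ρ := nonneg_of_mul_nonneg_left ((norm_nonneg _).trans (hr T le_rfl)) (exp_pos _)
    have hz : ∀ t ≤ T, ‖B (y t)‖ ≤ C * (‖B‖ * ρ) * exp (γ * t) := by
      refine hC (fun t => B (y t)) (fun t => B (r t)) (‖B‖ * ρ) γ T (‖B‖ * M) hγ ?_ ?_ ?_ ?_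
      · intro t ht
        have h1 := (B.restrictScalars ℝ).hasFDerivAt.comp_hasDerivAt t (hy t ht)
        refine h1.congr_deriv ?_
        simp [hB]
        abel
      · intro t ht
        rw [mul_assoc]
        exact (B.le_opNorm _).trans (mul_le_mul_of_nonneg_left (hr t ht) (norm_nonneg _))
      · intro t ht
        exact (B.le_opNorm _).trans (mul_le_mul_of_nonneg_left (hM t ht) (norm_nonneg _))
      · intro t
        have := h0 t
        rwa [pow_succ] at this
    have h1 := norm_le_of_stable (u := y) (r := fun t => B (y t) + r t)
      (ρ := C * (‖B‖ * ρ) + ρ) hμ hγ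
      (fun t ht => by
        have := hy t ht
        rw [hBx, add_assoc] at this
        exact this)
      (fun t ht => by
        have := norm_add_le (B (y t)) (r t)
        have := hz t ht
        have := hr t ht
        linarith) hM ht
    refine h1.trans ?_
    have h2 : C * (‖B‖ * ρ) + ρ = (C * ‖B‖ + 1) * ρ := by ring
    have h3 : γ - μ.re ≥ -μ.re := by linarith
    have h4 : 0 < -μ.re := by linarith
    have h5 : (C * (‖B‖ * ρ) + ρ) / (γ - μ.re) ≤ (C * ‖B‖ + 1) / -μ.re * ρ := by
      rw [h2, div_mul_eq_mul_div]
      gcongr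
    gcongr

theorem Finset.exists_pos_le {ι : Type*} (s : Finset ι) (f : ι → ℝ) (hf : ∀ i ∈ s, 0 < f i) :
    ∃ a, 0 < a ∧ ∀ i ∈ s, a ≤ f i := by
  classical
  induction s using Finset.induction_on with
  | empty => exact ⟨1, one_pos, by simp⟩
  | insert i s _ ih =>
    obtain ⟨a, ha, h⟩ := ih fun j hj => hf j (Finset.mem_insert_of_mem hj)
    refine ⟨min a (f i), lt_min ha (hf i (Finset.mem_insert_self _ _)), fun j hj => ?_⟩
    rcases Finset.mem_insert.1 hj with rfl | hj
    · exact min_le_right _ _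
    · exact (min_le_left _ _).trans (h j hj)

variable [FiniteDimensional ℂ V]

/-- Dichotomy estimate for bounded solutions of the inhomogeneous linear equation. -/
theorem IsUnstablySemisimple.exists_norm_le {A : V →L[ℂ] V} (hA : IsUnstablySemisimple A) :
    ∃ C a, 0 ≤ C ∧ 0 < a ∧ ∀ (y r : ℝ → V) (ρ T M : ℝ),
      (∀ t ≤ T, HasDerivAt y (A (y t) + r t) t) → (∀ t ≤ T, ‖r t‖ ≤ ρ) →
      (∀ t ≤ T, ‖y t‖ ≤ M) → ∀ t ≤ T, ‖y t‖ ≤ C * exp (a * (t - T)) * M + C * ρ := by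
  obtain ⟨s, P, heig, hsum, hP⟩ := hA.exists_projections
  have key : ∀ μ ∈ s, ∃ C a, 0 ≤ C ∧ 0 < a ∧ ∀ (y r : ℝ → V) (ρ T M : ℝ),
      (∀ t ≤ T, HasDerivAt y (A (y t) + r t) t) → (∀ t ≤ T, ‖r t‖ ≤ ρ) →
      (∀ t ≤ T, ‖y t‖ ≤ M) → ∀ t ≤ T, ‖P μ (y t)‖ ≤ C * exp (a * (t - T)) * M + C * ρ := by
    intro μ hμ
    obtain ⟨hcomm, ⟨k, hk⟩, huns⟩ := hP μ hμ
    have hd : ∀ (y r : ℝ → V) (t : ℝ), HasDerivAt y (A (y t) + r t) t →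
        HasDerivAt (fun t => P μ (y t)) (A (P μ (y t)) + P μ (r t)) t := by
      intro y r t h
      have h1 := ((P μ).restrictScalars ℝ).hasFDerivAt.comp_hasDerivAt t h
      refine h1.congr_deriv ?_
      simp [hcomm]
    have hb : ∀ (x : V) (c : ℝ), ‖x‖ ≤ c → ‖P μ x‖ ≤ ‖P μ‖ * c := fun x c h =>
      ((P μ).le_opNorm x).trans (mul_le_mul_of_nonneg_left h (norm_nonneg _))
    rcases lt_or_gt_of_ne (hA.re_ne_zero μ (heig μ hμ)) with hre | hre
    · obtain ⟨C, hC0, hC⟩ := exists_norm_le_of_stable_generalized A hre k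
      -- The rate `1` is arbitrary: the stable part is controlled by the forcing alone.
      refine ⟨C * ‖P μ‖, 1, by positivity, one_pos, fun y r ρ T M hy hr hM t ht => ?_⟩
      have := hC (fun t => P μ (y t)) (fun t => P μ (r t)) (‖P μ‖ * ρ) 0 T (‖P μ‖ * M) le_rfl
        (fun t ht => hd y r t (hy t ht)) (fun t ht => by simpa using hb _ _ (hr t ht))
        (fun t ht => hb _ _ (hM t ht)) (fun t => hk _) t ht
      have hM0 : 0 ≤ M := (norm_nonneg _).trans (hM T le_rfl)
      have h2 : 0 ≤ C * ‖P μ‖ * exp (1 * (t - T)) * M := by positivity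
      simp only [zero_mul, exp_zero, mul_one] at this
      linarith
    · refine ⟨‖P μ‖ * (1 + 1 / μ.re), μ.re, by positivity, hre, fun y r ρ T M hy hr hM t ht => ?_⟩
      have hM0 : 0 ≤ M := (norm_nonneg _).trans (hM T le_rfl)
      have hρ0 : 0 ≤ ρ := (norm_nonneg _).trans (hr T le_rfl)
      have := norm_le_of_unstable (u := fun t => P μ (y t)) (r := fun t => P μ (r t))
        (ρ := ‖P μ‖ * ρ) (γ := 0) hre
        (fun t ht => by
          have := hd y r t (hy t ht)
          rwa [huns hre] at this) (fun t ht => by simpa using hb _ _ (hr t ht)) ht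
      have h1 := mul_le_mul_of_nonneg_left (hb _ _ (hM T le_rfl)) (exp_pos (μ.re * (t - T))).le
      simp only [zero_mul, exp_zero, mul_one, sub_zero] at this
      have h2 : 0 ≤ ‖P μ‖ * (1 / μ.re) * exp (μ.re * (t - T)) * M := by positivity
      have h3 : 0 ≤ ‖P μ‖ * ρ := by positivity
      have h4 : ‖P μ‖ * ρ / μ.re = ‖P μ‖ * (1 / μ.re) * ρ := by ring
      rw [h4] at this
      nlinarith
  choose! C a hC0 ha hCa using key
  obtain ⟨a₀, ha₀, hle⟩ := s.exists_pos_le a ha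
  refine ⟨∑ μ ∈ s, C μ, a₀, Finset.sum_nonneg hC0, ha₀, fun y r ρ T M hy hr hM t ht => ?_⟩
  have hM0 : 0 ≤ M := (norm_nonneg _).trans (hM T le_rfl)
  rw [← hsum (y t), Finset.sum_mul, Finset.sum_mul, Finset.sum_mul, ← Finset.sum_add_distrib]
  refine norm_sum_le_of_le _ fun μ hμ => ?_
  refine (hCa μ hμ y r ρ T M hy hr hM t ht).trans ?_
  have h1 : exp (a μ * (t - T)) ≤ exp (a₀ * (t - T)) :=
    exp_le_exp.2 (by nlinarith [hle μ hμ])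
  have := hC0 μ hμ
  gcongr

/-- Bounded backward solutions of the linear equation with exponentially small inhomogeneity are
sums of unstable exponentials, up to an exponentially small error. -/
theorem IsUnstablySemisimple.exists_norm_sub_sum_cexp_le {A : V →L[ℂ] V}
    (hA : IsUnstablySemisimple A) {y r : ℝ → V} {ρ γ γ' T M : ℝ} (hγ' : 0 ≤ γ') (hγ : γ' < γ)
    (hT : T ≤ 0) (hy : ∀ t ≤ T, HasDerivAt y (A (y t) + r t) t)
    (hr : ∀ t ≤ T, ‖r t‖ ≤ ρ * exp (γ * t)) (hM : ∀ t ≤ T, ‖y t‖ ≤ M) :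
    ∃ (s : Finset ℂ) (b : ℂ → V),
      (∀ μ ∈ s, Module.End.HasEigenvalue (A : V →ₗ[ℂ] V) μ ∧ 0 < μ.re ∧ A (b μ) = μ • b μ) ∧
      ∃ C, ∀ t ≤ T, ‖y t - ∑ μ ∈ s, Complex.exp (μ * t) • b μ‖ ≤ C * exp (γ' * t) := by
  classical
  have : CompleteSpace V := FiniteDimensional.complete ℂ V
  obtain ⟨s, P, heig, hsum, hP⟩ := hA.exists_projections
  have hρ : 0 ≤ ρ := nonneg_of_mul_nonneg_left ((norm_nonneg _).trans (hr T le_rfl)) (exp_pos _)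
  have hb : ∀ μ (x : V) (c : ℝ), ‖x‖ ≤ c → ‖P μ x‖ ≤ ‖P μ‖ * c := fun μ x c h =>
    ((P μ).le_opNorm x).trans (mul_le_mul_of_nonneg_left h (norm_nonneg _))
  have hr' : ∀ μ, ∀ t ≤ T, ‖P μ (r t)‖ ≤ ‖P μ‖ * ρ * exp (γ * t) := fun μ t ht => by
    rw [mul_assoc]
    exact hb μ _ _ (hr t ht)
  have hd : ∀ μ ∈ s, ∀ t ≤ T,
      HasDerivAt (fun t => P μ (y t)) (A (P μ (y t)) + P μ (r t)) t := by
    intro μ hμ t ht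
    have h1 := ((P μ).restrictScalars ℝ).hasFDerivAt.comp_hasDerivAt t (hy t ht)
    refine h1.congr_deriv ?_
    simp [(hP μ hμ).1]
  have key : ∀ μ ∈ s, ∃ b : V, (0 < μ.re → A b = μ • b) ∧ (¬ 0 < μ.re → b = 0) ∧
      ∃ C, ∀ t ≤ T, ‖P μ (y t) - Complex.exp (μ * t) • b‖ ≤ C * exp (γ' * t) := by
    intro μ hμ
    obtain ⟨hcomm, ⟨k, hk⟩, huns⟩ := hP μ hμ
    rcases lt_or_gt_of_ne (hA.re_ne_zero μ (heig μ hμ)) with hre | hre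
    · obtain ⟨C, hC0, hC⟩ := exists_norm_le_of_stable_generalized A hre k
      refine ⟨0, fun h => absurd h hre.le.not_gt, fun _ => rfl, C * (‖P μ‖ * ρ), fun t ht => ?_⟩
      have := hC (fun t => P μ (y t)) (fun t => P μ (r t)) (‖P μ‖ * ρ) γ T (‖P μ‖ * M)
        (hγ'.trans hγ.le) (hd μ hμ) (hr' μ) (fun t ht => hb μ _ _ (hM t ht)) (fun t => hk _) t ht
      rw [smul_zero, sub_zero]
      refine this.trans (mul_le_mul_of_nonneg_left (exp_le_exp.2 ?_) (by positivity))
      nlinarith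
    · obtain ⟨b, hbL, hbC⟩ := exists_norm_sub_cexp_le (u := fun t => P μ (y t))
        (r := fun t => P μ (r t)) (μ := μ) hγ hT
        (fun t ht => by
          have := hd μ hμ t ht
          rwa [huns hre] at this) (hr' μ)
      refine ⟨b, fun _ => ?_, fun h => absurd hre h, hbC⟩
      -- The coefficient is an eigenvector because every operator that annihilates the component `P
      -- μ (y t)` also annihilates `b`.
      have := hbL (A - μ • ContinuousLinearMap.id ℂ V) fun t => by simp [huns hre]
      simpa [sub_eq_zero] using this
  choose! b hb1 hb2 C hC using key
  refine ⟨s.filter fun μ => 0 < μ.re, b, fun μ hμ => ?_, ∑ μ ∈ s, C μ, fun t ht => ?_⟩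
  · rw [Finset.mem_filter] at hμ
    exact ⟨heig μ hμ.1, hμ.2, hb1 μ hμ.1 hμ.2⟩
  · have h1 : ∑ μ ∈ s.filter (fun μ => 0 < μ.re), Complex.exp (μ * t) • b μ
        = ∑ μ ∈ s, Complex.exp (μ * t) • b μ := by
      refine Finset.sum_filter_of_ne fun μ hμ hne => ?_
      by_contra h
      exact hne (by rw [hb2 μ hμ h, smul_zero])
    rw [h1, ← hsum (y t), ← Finset.sum_sub_distrib, Finset.sum_mul]
    exact norm_sum_le_of_le _ fun μ hμ => hC μ hμ t ht

/-- Solutions converging to a hyperbolic equilibrium converge exponentially fast. -/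
theorem IsUnstablySemisimple.exists_norm_le_exp {A : V →L[ℂ] V} (hA : IsUnstablySemisimple A)
    {w r : ℝ → V} (hw : ∀ t, HasDerivAt w (A (w t) + r t) t)
    (hr : ∀ ε > 0, ∀ᶠ t in atBot, ‖r t‖ ≤ ε * ‖w t‖) (hw0 : Tendsto w atBot (𝓝 0)) :
    ∃ α C T, 0 < α ∧ ∀ t ≤ T, ‖w t‖ ≤ C * exp (α * t) := by
  obtain ⟨C, a, hC0, ha, hC⟩ := hA.exists_norm_le
  -- With `C exp (-a L) ≤ 1/4` and `C ε ≤ 1/4`, the dichotomy estimate halves the bound on `w`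
  -- whenever time moves back by `L`. This gives the rate `log 2 / L`; the floor below loses at most
  -- one such window, which the constant absorbs.
  obtain ⟨L, hL0, hL⟩ : ∃ L, 0 < L ∧ C * exp (-(a * L)) ≤ 1 / 4 := by
    have h1 : Tendsto (fun L : ℝ => C * exp (-(a * L))) atTop (𝓝 0) := by
      have := (tendsto_exp_neg_atTop_nhds_zero.comp
        (tendsto_id.const_mul_atTop ha)).const_mul C
      simpa using this
    obtain ⟨L, h2, h3⟩ := ((h1.eventually (ge_mem_nhds (by norm_num : (0 : ℝ) < 1 / 4))).and
      (eventually_gt_atTop 0)).exists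
    exact ⟨L, h3, h2⟩
  set ε : ℝ := 1 / (4 * (C + 1)) with hε
  have hε0 : 0 < ε := by positivity
  have hCε : C * ε ≤ 1 / 4 := by
    rw [hε, mul_one_div, div_le_div_iff₀ (by positivity) (by norm_num)]
    linarith
  have hw1 : ∀ᶠ t in atBot, ‖w t‖ ≤ 1 := by
    have := hw0.norm
    rw [norm_zero] at this
    exact this.eventually (ge_mem_nhds one_pos)
  obtain ⟨T, hT⟩ := eventually_atBot.1 ((hr ε hε0).and hw1)
  have claim : ∀ n : ℕ, ∀ t ≤ T - n * L, ‖w t‖ ≤ (1 / 2) ^ n := by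
    intro n
    induction n with
    | zero =>
      intro t ht
      simpa using (hT t (by simpa using ht)).2
    | succ n ih =>
      intro t ht
      push_cast at ht
      have hnL : 0 ≤ n * L := by positivity
      have h1 := hC w r (ε * (1 / 2) ^ n) (t + L) ((1 / 2) ^ n) (fun t _ => hw t)
        (fun x hx => ((hT x (by linarith)).1).trans
          (mul_le_mul_of_nonneg_left (ih x (by linarith)) hε0.le))
        (fun x hx => ih x (by linarith)) t (by linarith)
      have h2 : a * (t - (t + L)) = -(a * L) := by ring
      rw [h2] at h1
      have h3 : (0 : ℝ) < (1 / 2) ^ n := by positivity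
      rw [pow_succ]
      nlinarith
  refine ⟨log 2 / L, exp (log 2 * (1 - T / L)), T, div_pos (log_pos (by norm_num)) hL0,
    fun t ht => ?_⟩
  set n := ⌊(T - t) / L⌋₊ with hn
  have hfl : (n : ℝ) ≤ (T - t) / L := Nat.floor_le (div_nonneg (by linarith) hL0.le)
  have hfl2 : (T - t) / L < n + 1 := Nat.lt_floor_add_one _
  have h1 := claim n t (by
    rw [le_div_iff₀ hL0] at hfl
    linarith)
  refine h1.trans ?_
  have h2 : ((1 : ℝ) / 2) ^ n = exp (-(log 2 * n)) := by
    rw [one_div, inv_pow, exp_neg, exp_mul, exp_log (by norm_num), rpow_natCast]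
  rw [h2, ← exp_add]
  refine exp_le_exp.2 ?_
  have h3 : 0 < log 2 := log_pos (by norm_num)
  have h4 : log 2 * (1 - T / L) + log 2 / L * t = -(log 2 * ((T - t) / L - 1)) := by ring
  rw [h4]
  nlinarith

end LinearSystem

/-! ### Exponential sums with real frequencies -/

section ExponentialSums

open Real

variable (V : Type*) [NormedAddCommGroup V] [NormedSpace ℂ V]

/-- Finite sums of exponentials `z ↦ exp (ν z) a` with frequencies `ν` in `S`. -/
def expSums (S : Set ℝ) : Submodule ℂ (ℂ → V) :=
  Submodule.span ℂ {q | ∃ ν ∈ S, ∃ a : V, q = fun z => Complex.exp (ν * z) • a}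

variable {V} {S : Set ℝ} {q : ℂ → V}

theorem cexp_smul_mem_expSums {ν : ℝ} (hν : ν ∈ S) (a : V) :
    (fun z : ℂ => Complex.exp (ν * z) • a) ∈ expSums V S :=
  Submodule.subset_span ⟨ν, hν, a, rfl⟩

theorem expSums_mono {S' : Set ℝ} (h : S ⊆ S') : expSums V S ≤ expSums V S' :=
  Submodule.span_mono fun _ ⟨ν, hν, a, e⟩ => ⟨ν, h hν, a, e⟩

theorem exists_finset_of_mem_expSums (hq : q ∈ expSums V S) :
    ∃ (s : Finset ℝ) (c : ℝ → V), ↑s ⊆ S ∧ q = fun z => ∑ ν ∈ s, Complex.exp (ν * z) • c ν := by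
  classical
  induction hq using Submodule.span_induction with
  | mem q hq =>
    obtain ⟨ν, hν, a, rfl⟩ := hq
    exact ⟨{ν}, fun _ => a, by simpa using hν, by simp⟩
  | zero => exact ⟨∅, 0, by simp, by funext z; simp⟩
  | add q₁ q₂ _ _ h₁ h₂ =>
    obtain ⟨s, c, hs, rfl⟩ := h₁
    obtain ⟨t, d, ht, rfl⟩ := h₂
    refine ⟨s ∪ t, fun ν => (if ν ∈ s then c ν else 0) + if ν ∈ t then d ν else 0,
      by simp [hs, ht], ?_⟩
    funext z
    simp only [Pi.add_apply, smul_add, Finset.sum_add_distrib, smul_ite, smul_zero,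
      Finset.sum_ite_mem]
    congr 2
    · ext; simp +contextual
    · ext; simp +contextual
  | smul k q _ h =>
    obtain ⟨s, c, hs, rfl⟩ := h
    refine ⟨s, fun ν => k • c ν, hs, ?_⟩
    funext z
    simp only [Pi.smul_apply, Finset.smul_sum]
    exact Finset.sum_congr rfl fun ν _ => smul_comm _ _ _

theorem norm_cexp_ofReal_mul (ν : ℝ) (z : ℂ) : ‖Complex.exp (ν * z)‖ = exp (ν * z.re) := by
  simp [Complex.norm_exp]

theorem norm_sum_cexp_smul_le {s : Finset ℝ} {c : ℝ → V} {β : ℝ} (h : ∀ ν ∈ s, β ≤ ν) {z : ℂ}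
    (hz : z.re ≤ 0) :
    ‖∑ ν ∈ s, Complex.exp (ν * z) • c ν‖ ≤ (∑ ν ∈ s, ‖c ν‖) * exp (β * z.re) := by
  rw [Finset.sum_mul]
  refine norm_sum_le_of_le _ fun ν hν => ?_
  rw [norm_smul, norm_cexp_ofReal_mul, mul_comm]
  exact mul_le_mul_of_nonneg_left (exp_le_exp.2 (by nlinarith [h ν hν])) (norm_nonneg _)

theorem exists_norm_le_of_mem_expSums {β : ℝ} (h : ∀ ν ∈ S, β ≤ ν) (hq : q ∈ expSums V S) :
    ∃ C, 0 ≤ C ∧ ∀ z : ℂ, z.re ≤ 0 → ‖q z‖ ≤ C * exp (β * z.re) := by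
  obtain ⟨s, c, hs, rfl⟩ := exists_finset_of_mem_expSums hq
  exact ⟨∑ ν ∈ s, ‖c ν‖, Finset.sum_nonneg fun _ _ => norm_nonneg _,
    fun z hz => norm_sum_cexp_smul_le (fun ν hν => h ν (hs hν)) hz⟩

/-- Exponential decay of an exponential sum along the negative real axis propagates to the
left half-plane. -/
theorem exists_norm_le_of_norm_ofReal_le {β C T : ℝ} (hq : q ∈ expSums V S)
    (h : ∀ t : ℝ, t ≤ T → ‖q t‖ ≤ C * exp (β * t)) :
    ∃ C, 0 ≤ C ∧ ∀ z : ℂ, z.re ≤ 0 → ‖q z‖ ≤ C * exp (β * z.re) := by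
  classical
  obtain ⟨s, c, -, rfl⟩ := exists_finset_of_mem_expSums hq
  clear hq
  -- Frequencies are removed from the smallest upwards. If the smallest one, `a`, is below `β`, then
  -- multiplication by `exp (-a t)` and passage to `-∞` isolate its coefficient, which must vanish.
  induction s using Finset.induction_on_min with
  | empty => exact ⟨0, le_rfl, by simp⟩
  | insert a s ha ih =>
    have has : a ∉ s := fun h => lt_irrefl _ (ha a h)
    rcases le_or_gt β a with hβ | hβ
    · refine ⟨_, Finset.sum_nonneg fun _ _ => norm_nonneg _, fun z hz =>
        norm_sum_cexp_smul_le (s := insert a s) (c := c) (fun ν hν => ?_) hz⟩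
      rcases Finset.mem_insert.1 hν with rfl | hν
      · exact hβ
      · exact hβ.trans (ha ν hν).le
    · have hexp : ∀ κ : ℝ, 0 < κ → Tendsto (fun t : ℝ => exp (κ * t)) atBot (𝓝 0) := fun κ hκ =>
        tendsto_exp_atBot.comp (tendsto_id.const_mul_atBot hκ)
      have hc : c a = 0 := by
        have h1 : Tendsto (fun t : ℝ => c a + ∑ ν ∈ s, Complex.exp ((ν - a : ℝ) * t) • c ν)
            atBot (𝓝 (c a + ∑ ν ∈ s, 0)) := by
          refine tendsto_const_nhds.add (tendsto_finsetSum _ fun ν hν => ?_)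
          rw [tendsto_zero_iff_norm_tendsto_zero]
          have := (hexp (ν - a) (sub_pos.2 (ha ν hν))).mul_const ‖c ν‖
          rw [zero_mul] at this
          refine this.congr fun t => ?_
          rw [norm_smul, norm_cexp_ofReal_mul, Complex.ofReal_re]
        have h2 : Tendsto (fun t : ℝ => c a + ∑ ν ∈ s, Complex.exp ((ν - a : ℝ) * t) • c ν)
            atBot (𝓝 0) := by
          have h3 := (hexp (β - a) (sub_pos.2 hβ)).const_mul C
          rw [mul_zero] at h3
          refine squeeze_zero_norm' ?_ h3
          filter_upwards [eventually_le_atBot T] with t ht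
          have h4 : c a + ∑ ν ∈ s, Complex.exp ((ν - a : ℝ) * t) • c ν =
              Complex.exp ((-a : ℝ) * t) • ∑ ν ∈ insert a s, Complex.exp (ν * t) • c ν := by
            rw [Finset.sum_insert has, smul_add, smul_smul, ← Complex.exp_add, Finset.smul_sum]
            congr 1
            · simp
            · refine Finset.sum_congr rfl fun ν _ => ?_
              rw [smul_smul, ← Complex.exp_add]
              congr 2
              push_cast
              ring
          rw [h4, norm_smul, norm_cexp_ofReal_mul, Complex.ofReal_re]
          calc exp (-a * t) * _ ≤ exp (-a * t) * (C * exp (β * t)) := by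
                gcongr
                exact h t ht
            _ = C * (exp (-a * t) * exp (β * t)) := by ring
            _ = _ := by rw [← exp_add]; ring_nf
        simpa using tendsto_nhds_unique h1 h2
      simp only [Finset.sum_insert has, hc, smul_zero, zero_add] at h ⊢
      exact ih h

/-- Multilinear expansion produces one exponential for each tuple of frequencies, with their sum as
its frequency. -/
theorem multilinear_mem_expSums {W : Type*} [NormedAddCommGroup W] [NormedSpace ℂ W] {k : ℕ}
    (p : ContinuousMultilinearMap ℂ (fun _ : Fin k => V) W) {S' : Set ℝ}
    (hS : ∀ f : Fin k → ℝ, (∀ i, f i ∈ S) → ∑ i, f i ∈ S') (hq : q ∈ expSums V S) :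
    (fun z => p fun _ => q z) ∈ expSums W S' := by
  classical
  obtain ⟨s, c, hs, rfl⟩ := exists_finset_of_mem_expSums hq
  have h : (fun z : ℂ => p fun _ => ∑ ν ∈ s, Complex.exp (ν * z) • c ν) =
      ∑ f ∈ Fintype.piFinset fun _ : Fin k => s, fun z : ℂ =>
        Complex.exp ((∑ i, f i : ℝ) * z) • p fun i => c (f i) := by
    funext z
    rw [p.map_sum_finset, Finset.sum_apply]
    refine Finset.sum_congr rfl fun f _ => ?_
    rw [p.map_smul_univ, ← Complex.exp_sum]
    congr 2
    push_cast
    rw [Finset.sum_mul]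
  rw [h]
  refine Submodule.sum_mem _ fun f hf => cexp_smul_mem_expSums (hS f fun i => ?_) _
  exact hs (Fintype.mem_piFinset.1 hf i)

theorem hasDerivAt_cexp_smul (ν : ℝ) (a : V) (z : ℂ) :
    HasDerivAt (fun z : ℂ => Complex.exp (ν * z) • a) (Complex.exp (ν * z) • ((ν : ℂ) • a)) z := by
  have h1 : HasDerivAt (fun z : ℂ => Complex.exp (ν * z)) (Complex.exp (ν * z) * ν) z := by
    simpa using ((hasDerivAt_id z).const_mul (ν : ℂ)).cexp
  exact (h1.smul_const a).congr_deriv (mul_smul _ _ _)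

/-- Away from resonances the inhomogeneous linear equation has an exponential sum solution. -/
theorem exists_expSum_solution [FiniteDimensional ℂ V] (A : V →L[ℂ] V)
    (hS : ∀ ν ∈ S, ¬ Module.End.HasEigenvalue (A : V →ₗ[ℂ] V) (ν : ℂ)) (hq : q ∈ expSums V S) :
    ∃ Q ∈ expSums V S, ∀ z, HasDerivAt Q (A (Q z) + q z) z := by
  induction hq using Submodule.span_induction with
  | mem q hq =>
    obtain ⟨ν, hν, a, rfl⟩ := hq
    -- A forcing `exp (ν z) a` is answered by `exp (ν z) b` with `(ν - A) b = a`, which is solvable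
    -- because `ν` is not an eigenvalue.
    have hinj : Function.Injective
        ((ν : ℂ) • LinearMap.id - (A : V →ₗ[ℂ] V) : V →ₗ[ℂ] V) := by
      rw [← LinearMap.ker_eq_bot, LinearMap.ker_eq_bot']
      intro x hx
      by_contra hne
      refine hS ν hν (Module.End.hasEigenvalue_of_hasEigenvector (x := x)
        ⟨Module.End.mem_eigenspace_iff.2 ?_, hne⟩)
      exact (sub_eq_zero.1 hx).symm
    obtain ⟨b, hb⟩ := LinearMap.surjective_of_injective hinj a
    have hb' : (ν : ℂ) • b = A b + a := by
      rw [← hb]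
      simp
    refine ⟨_, cexp_smul_mem_expSums hν b, fun z => ?_⟩
    convert hasDerivAt_cexp_smul ν b z using 1
    rw [hb', map_smul, smul_add]
  | zero => exact ⟨0, Submodule.zero_mem _, fun z => by simp⟩
  | add q₁ q₂ _ _ h₁ h₂ =>
    obtain ⟨Q₁, hQ₁, hd₁⟩ := h₁
    obtain ⟨Q₂, hQ₂, hd₂⟩ := h₂
    refine ⟨Q₁ + Q₂, Submodule.add_mem _ hQ₁ hQ₂, fun z => ?_⟩
    refine ((hd₁ z).add (hd₂ z)).congr_deriv ?_
    simp only [Pi.add_apply, map_add]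
    abel
  | smul k q _ h =>
    obtain ⟨Q, hQ, hd⟩ := h
    refine ⟨k • Q, Submodule.smul_mem _ k hQ, fun z => ?_⟩
    refine ((hd z).const_smul k).congr_deriv ?_
    simp only [Pi.smul_apply, map_smul, smul_add]

/-- Exponential sums are almost periodic in the imaginary direction. -/
theorem frequently_norm_sub_lt_of_mem_expSums (hq : q ∈ expSums V S) (z : ℂ) {ε : ℝ}
    (hε : 0 < ε) :
    ∃ᶠ n : ℕ in atTop, ‖q (z + n * Complex.I) - q z‖ < ε ∧ ‖q (z - n * Complex.I) - q z‖ < ε := by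
  obtain ⟨s, c, -, rfl⟩ := exists_finset_of_mem_expSums hq
  -- Simultaneous recurrence of all the phases: in the compact group `ℝ → Circle` the identity is a
  -- cluster point of the powers of any element. Continuity of inversion treats `n` and `-n` with
  -- the same `n`.
  let x : ℝ → Circle := fun ν => Circle.exp ν
  have hclus : MapClusterPt 1 atTop (x ^ · : ℕ → (ℝ → Circle)) := mapClusterPt_one_atTop_pow x
  let Φ : (ℝ → Circle) → V := fun y => ∑ ν ∈ s, (Complex.exp (ν * z) * (y ν : ℂ)) • c ν
  have hΦ : Continuous Φ := by fun_prop
  have h1 : ∀ᶠ y in 𝓝 (1 : ℝ → Circle), ‖Φ y - Φ 1‖ < ε ∧ ‖Φ y⁻¹ - Φ 1‖ < ε := by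
    have e1 : Tendsto (fun y => ‖Φ y - Φ 1‖) (𝓝 1) (𝓝 ‖Φ 1 - Φ 1‖) :=
      ((hΦ.sub continuous_const).norm).tendsto 1
    have e2 : Tendsto (fun y => ‖Φ y⁻¹ - Φ 1‖) (𝓝 1) (𝓝 ‖Φ 1⁻¹ - Φ 1‖) :=
      (((hΦ.comp continuous_inv).sub continuous_const).norm).tendsto 1
    rw [inv_one] at e2
    rw [sub_self, norm_zero] at e1 e2
    exact (e1.eventually (gt_mem_nhds hε)).and (e2.eventually (gt_mem_nhds hε))
  have hpow : ∀ (n : ℕ) (ν : ℝ), (((x ^ n) ν : Circle) : ℂ) = Complex.exp (ν * (n * Complex.I)) := by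
    intro n ν
    simp only [x, Pi.pow_apply, Circle.coe_pow, Circle.coe_exp, ← Complex.exp_nat_mul]
    ring_nf
  refine (hclus.frequently h1).mono fun n hn => ?_
  have e0 : Φ 1 = ∑ ν ∈ s, Complex.exp (ν * z) • c ν := by simp [Φ]
  have e1 : Φ (x ^ n) = ∑ ν ∈ s, Complex.exp (ν * (z + n * Complex.I)) • c ν := by
    refine Finset.sum_congr rfl fun ν _ => ?_
    rw [hpow, ← Complex.exp_add, mul_add]
  have e2 : Φ (x ^ n)⁻¹ = ∑ ν ∈ s, Complex.exp (ν * (z - n * Complex.I)) • c ν := by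
    refine Finset.sum_congr rfl fun ν _ => ?_
    rw [Pi.inv_apply, Circle.coe_inv, hpow, ← Complex.exp_neg, ← Complex.exp_add, mul_sub,
      sub_eq_add_neg]
  rw [e0, e1, e2] at hn
  exact hn

end ExponentialSums

/-! ### Sums of eigenvalues as frequencies -/

section Frequencies

/-- The real numbers which are sums of at least `k` elements of `Λ`. -/
def frequencies (Λ : Set ℂ) (k : ℕ) : Set ℝ :=
  {x | ∃ n : ℂ →₀ ℕ, (n.support : Set ℂ) ⊆ Λ ∧ k ≤ (n.sum fun _ m => m) ∧
    (x : ℂ) = n.sum fun μ m => (m : ℂ) * μ}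

variable {Λ : Set ℂ}

theorem frequencies_anti {j k : ℕ} (h : j ≤ k) : frequencies Λ k ⊆ frequencies Λ j :=
  fun _ ⟨n, h1, h2, h3⟩ => ⟨n, h1, h.trans h2, h3⟩

theorem zero_mem_frequencies : 0 ∈ frequencies Λ 0 := ⟨0, by simp, by simp, by simp⟩

theorem add_mem_frequencies {j k : ℕ} {x y : ℝ} (hx : x ∈ frequencies Λ j)
    (hy : y ∈ frequencies Λ k) : x + y ∈ frequencies Λ (j + k) := by
  classical
  obtain ⟨m, hm1, hm2, hm3⟩ := hx
  obtain ⟨n, hn1, hn2, hn3⟩ := hy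
  refine ⟨m + n, fun μ hμ => ?_, ?_, ?_⟩
  · rcases Finset.mem_union.1 (Finsupp.support_add hμ) with h | h
    · exact hm1 h
    · exact hn1 h
  · rw [Finsupp.sum_add_index' (fun _ => rfl) (fun _ _ _ => rfl)]
    exact add_le_add hm2 hn2
  · rw [Finsupp.sum_add_index' (by simp) (by intros; push_cast; ring), ← hm3, ← hn3]
    push_cast
    rfl

theorem sum_mem_frequencies {k : ℕ} (f : Fin k → ℝ) (hf : ∀ i, f i ∈ frequencies Λ 1) :
    ∑ i, f i ∈ frequencies Λ k := by
  induction k with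
  | zero => simpa using zero_mem_frequencies
  | succ k ih =>
    rw [Fin.sum_univ_castSucc]
    exact add_mem_frequencies (ih _ fun i => hf _) (hf _)

theorem re_mem_frequencies {μ : ℂ} (hμ : μ ∈ Λ) (him : μ.im = 0) : μ.re ∈ frequencies Λ 1 := by
  refine ⟨Finsupp.single μ 1, ?_, ?_, ?_⟩
  · intro x hx
    have : x = μ := by simpa using Finsupp.support_single_subset hx
    rwa [this]
  · simp
  · rw [Finsupp.sum_single_index (by simp)]
    apply Complex.ext <;> simp [him]

theorem mul_le_of_mem_frequencies {α x : ℝ} {k : ℕ} (hα : 0 ≤ α) (h : ∀ μ ∈ Λ, α ≤ μ.re)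
    (hx : x ∈ frequencies Λ k) : k * α ≤ x := by
  obtain ⟨n, h1, h2, h3⟩ := hx
  have h4 : x = ∑ μ ∈ n.support, (n μ : ℝ) * μ.re := by
    have := congrArg Complex.re h3
    rw [Complex.ofReal_re, Finsupp.sum, Complex.re_sum] at this
    rw [this]
    exact Finset.sum_congr rfl fun μ _ => by simp
  have h5 : (k : ℝ) ≤ ∑ μ ∈ n.support, (n μ : ℝ) := by
    exact_mod_cast h2
  calc k * α ≤ (∑ μ ∈ n.support, (n μ : ℝ)) * α := by gcongr
    _ = ∑ μ ∈ n.support, (n μ : ℝ) * α := Finset.sum_mul _ _ _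
    _ ≤ _ := by
      rw [h4]
      exact Finset.sum_le_sum fun μ hμ =>
        mul_le_mul_of_nonneg_left (h μ (h1 hμ)) (Nat.cast_nonneg _)

end Frequencies

/-! ### Asymptotic expansion along the unstable manifold -/

section Expansion

open Real

variable {V : Type*} [NormedAddCommGroup V] [NormedSpace ℂ V]

/-- All degrees are at least two, so the Lipschitz constant on a ball of radius `ρ ≤ 1` carries a
factor `ρ`. This factor provides the gain in each expansion step. -/
theorem exists_multilinearSum_sub_le (p : ∀ k : ℕ, ContinuousMultilinearMap ℂ (fun _ : Fin k => V) V)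
    (M : ℕ) :
    ∃ C, 0 ≤ C ∧ ∀ ρ ≤ 1, ∀ x y, ‖x‖ ≤ ρ → ‖y‖ ≤ ρ →
      ‖multilinearSum p 2 M x - multilinearSum p 2 M y‖ ≤ C * ρ * ‖x - y‖ := by
  refine ⟨∑ k ∈ Finset.Ico 2 M, ‖p k‖ * k, Finset.sum_nonneg fun _ _ => by positivity,
    fun ρ hρ x y hx hy => ?_⟩
  have hρ0 : 0 ≤ ρ := (norm_nonneg x).trans hx
  rw [multilinearSum, multilinearSum, ← Finset.sum_sub_distrib, Finset.sum_mul, Finset.sum_mul]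
  refine norm_sum_le_of_le _ fun k hk => ?_
  have hk2 : 2 ≤ k := (Finset.mem_Ico.1 hk).1
  refine ((p k).norm_image_sub_le _ _).trans ?_
  rw [Fintype.card_fin]
  have h1 : max ‖fun _ : Fin k => x‖ ‖fun _ : Fin k => y‖ ≤ ρ :=
    max_le ((pi_norm_const_le x).trans hx) ((pi_norm_const_le y).trans hy)
  have h2 : max ‖fun _ : Fin k => x‖ ‖fun _ : Fin k => y‖ ^ (k - 1) ≤ ρ :=
    (pow_le_pow_left₀ (le_max_of_le_left (norm_nonneg _)) h1 _).trans
      (pow_le_of_le_one hρ0 hρ (by omega))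
  have h3 : ‖(fun _ : Fin k => x) - fun _ : Fin k => y‖ ≤ ‖x - y‖ := pi_norm_const_le (x - y)
  gcongr

/-- The nonlinear part of an entire vector field, up to terms of high order, is a Lipschitz small
map which preserves exponential sums. -/
theorem exists_nonlinear_part [FiniteDimensional ℂ V] {f : V → V} (hf : Differentiable ℂ f)
    (h0 : f 0 = 0) {M : ℕ} (hM : 2 ≤ M) (Λ : Set ℂ) :
    ∃ (g : V → V) (C : ℝ), 0 ≤ C ∧
      (∀ ρ ≤ 1, ∀ x y, ‖x‖ ≤ ρ → ‖y‖ ≤ ρ → ‖g x - g y‖ ≤ C * ρ * ‖x - y‖) ∧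
      (∀ Q ∈ expSums V (frequencies Λ 1), (fun z => g (Q z)) ∈ expSums V (frequencies Λ 2)) ∧
      ∀ y, ‖y‖ ≤ 1 → ‖f y - fderiv ℂ f 0 y - g y‖ ≤ C * ‖y‖ ^ M := by
  obtain ⟨p, hp0, hp1, C, hC0, hC⟩ := exists_taylor_of_differentiable (0 : V) M hf
  obtain ⟨C', hC0', hC'⟩ := exists_multilinearSum_sub_le p M
  refine ⟨multilinearSum p 2 M, max C C', le_max_of_le_left hC0, fun ρ hρ x y hx hy => ?_,
    fun Q hQ => ?_, fun y hy => ?_⟩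
  · have hρ0 : 0 ≤ ρ := (norm_nonneg x).trans hx
    refine (hC' ρ hρ x y hx hy).trans ?_
    gcongr
    exact le_max_right _ _
  · have h1 : (fun z => multilinearSum p 2 M (Q z)) =
        ∑ k ∈ Finset.Ico 2 M, fun z => p k fun _ => Q z := by
      funext z
      rw [Finset.sum_apply, multilinearSum]
    rw [h1]
    refine Submodule.sum_mem _ fun k hk => multilinear_mem_expSums _ (fun F hF => ?_) hQ
    exact frequencies_anti (Finset.mem_Ico.1 hk).1 (sum_mem_frequencies F hF)
  · have h1 : multilinearSum p 0 M y = fderiv ℂ f 0 y + multilinearSum p 2 M y := by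
      rw [multilinearSum, Finset.sum_eq_sum_Ico_succ_bot (by omega),
        Finset.sum_eq_sum_Ico_succ_bot (by omega), hp0 (by omega), hp1 (by omega), h0, zero_add]
      rfl
    have h2 := hC y hy
    rw [zero_add, h1, ← sub_sub] at h2
    refine h2.trans ?_
    gcongr
    exact le_max_left _ _

/-- The unstable eigenvalues of an operator. -/
def unstableEigenvalues (A : V →L[ℂ] V) : Set ℂ :=
  {μ | Module.End.HasEigenvalue (A : V →ₗ[ℂ] V) μ ∧ 0 < μ.re}

/-- Every eigenvalue is off the imaginary axis, and the unstable ones are real, semisimple and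
nonresonant. -/
structure IsUnstablyNonresonant (A : V →L[ℂ] V) : Prop extends IsUnstablySemisimple A where
  im_eq_zero : ∀ μ ∈ unstableEigenvalues A, μ.im = 0
  nonresonant : Nonresonant (unstableEigenvalues A)

variable {A : V →L[ℂ] V}

/-- Such an `x` is at least `2 α > 0`; as an eigenvalue it would be unstable, and nonresonance
forbids this. -/
theorem not_hasEigenvalue_of_mem_frequencies (hA : IsUnstablyNonresonant A) {α : ℝ} (hα : 0 < α)
    (hle : ∀ μ ∈ unstableEigenvalues A, α ≤ μ.re) {x : ℝ}
    (hx : x ∈ frequencies (unstableEigenvalues A) 2) :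
    ¬ Module.End.HasEigenvalue (A : V →ₗ[ℂ] V) (x : ℂ) := by
  intro he
  have h1 := mul_le_of_mem_frequencies hα.le hle hx
  obtain ⟨n, h2, h3, h4⟩ := hx
  refine hA.nonresonant x ⟨he, ?_⟩ n h2 h3 h4
  rw [Complex.ofReal_re]
  push_cast at h1
  linarith

/-- One step of the asymptotic expansion of a solution in the unstable manifold. -/
theorem exists_expansion_step [FiniteDimensional ℂ V] (hA : IsUnstablyNonresonant A) {f g : V → V}
    {w : ℝ → V} {Q : ℂ → V} {C α δ : ℝ} {M : ℕ} (hα : 0 < α) (hδ : 0 ≤ δ)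
    (hle : ∀ μ ∈ unstableEigenvalues A, α ≤ μ.re) (hC0 : 0 ≤ C)
    (hg : ∀ ρ ≤ 1, ∀ x y, ‖x‖ ≤ ρ → ‖y‖ ≤ ρ → ‖g x - g y‖ ≤ C * ρ * ‖x - y‖)
    (hgexp : ∀ Q ∈ expSums V (frequencies (unstableEigenvalues A) 1),
      (fun z => g (Q z)) ∈ expSums V (frequencies (unstableEigenvalues A) 2))
    (hfg : ∀ y, ‖y‖ ≤ 1 → ‖f y - A y - g y‖ ≤ C * ‖y‖ ^ M)
    (hw : ∀ t, HasDerivAt w (f (w t)) t) (hwα : ∃ C T, ∀ t ≤ T, ‖w t‖ ≤ C * exp (α * t))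
    (hM : δ + α ≤ M * α) (hQ : Q ∈ expSums V (frequencies (unstableEigenvalues A) 1))
    (hwQ : ∃ C T, ∀ t ≤ T, ‖w t - Q t‖ ≤ C * exp (δ * t)) :
    ∃ Q' ∈ expSums V (frequencies (unstableEigenvalues A) 1),
      (∀ z, HasDerivAt Q' (A (Q' z) + g (Q z)) z) ∧
      ∃ C T, ∀ t : ℝ, t ≤ T → ‖w t - Q' t‖ ≤ C * exp ((δ + α / 2) * t) := by
  -- Picard-type iteration inside the exponential sums: `P` solves `P' = A P + g Q`. The difference
  -- `w - P` then solves the linear equation with forcing `r` of order `exp ((δ + α) t)`: one factor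
  -- `exp (α t)` comes from the small Lipschitz constant of `g`.
  obtain ⟨P, hP, hPd⟩ := exists_expSum_solution A
    (fun ν hν => not_hasEigenvalue_of_mem_frequencies hA hα hle hν) (hgexp Q hQ)
  have hlow : ∀ ν ∈ frequencies (unstableEigenvalues A) 1, α ≤ ν := fun ν hν => by
    simpa using mul_le_of_mem_frequencies hα.le hle hν
  replace hP := expSums_mono (frequencies_anti one_le_two) hP
  obtain ⟨Cw, Tw, hCw⟩ := hwα
  obtain ⟨Cd, Td, hCd⟩ := hwQ
  obtain ⟨CQ, hCQ0, hCQ⟩ := exists_norm_le_of_mem_expSums hlow hQ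
  obtain ⟨CP, hCP0, hCP⟩ := exists_norm_le_of_mem_expSums hlow hP
  set D := max (|Cw|) CQ with hD
  have hD0 : 0 ≤ D := le_max_of_le_right hCQ0
  obtain ⟨T, hT0, hTw, hTd, hTD⟩ : ∃ T, T ≤ 0 ∧ T ≤ Tw ∧ T ≤ Td ∧
      ∀ t ≤ T, D * exp (α * t) ≤ 1 := by
    have h1 : Tendsto (fun t : ℝ => D * exp (α * t)) atBot (𝓝 0) := by
      have := (tendsto_exp_atBot.comp (tendsto_id.const_mul_atBot hα)).const_mul D
      simpa using this
    obtain ⟨T, hT⟩ := eventually_atBot.1 (h1.eventually (ge_mem_nhds one_pos))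
    exact ⟨min (min 0 T) (min Tw Td), by simp, by simp, by simp,
      fun t ht => hT t (ht.trans ((min_le_left _ _).trans (min_le_right _ _)))⟩
  have hwD : ∀ t ≤ T, ‖w t‖ ≤ D * exp (α * t) := fun t ht =>
    (hCw t (ht.trans hTw)).trans (mul_le_mul_of_nonneg_right
      ((le_abs_self _).trans (le_max_left _ _)) (exp_pos _).le)
  have hQD : ∀ t : ℝ, t ≤ T → ‖Q t‖ ≤ D * exp (α * t) := fun t ht =>
    (by simpa using hCQ t (by simpa using ht.trans hT0) : ‖Q t‖ ≤ CQ * exp (α * t)).trans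
      (mul_le_mul_of_nonneg_right (le_max_right _ _) (exp_pos _).le)
  set r : ℝ → V := fun t => f (w t) - A (w t) - g (Q t) with hr
  have hrb : ∀ t ≤ T, ‖r t‖ ≤ (C * D ^ M + C * D * |Cd|) * exp ((δ + α) * t) := by
    intro t ht
    have h1 := hfg (w t) ((hwD t ht).trans (hTD t ht))
    have h2 := hg _ (hTD t ht) (w t) (Q t) (hwD t ht) (hQD t ht)
    have h3 : ‖r t‖ ≤ ‖f (w t) - A (w t) - g (w t)‖ + ‖g (w t) - g (Q t)‖ := by
      have : r t = (f (w t) - A (w t) - g (w t)) + (g (w t) - g (Q t)) := by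
        simp only [hr]
        abel
      rw [this]
      exact norm_add_le _ _
    have h4 : ‖w t‖ ^ M ≤ D ^ M * exp ((δ + α) * t) := by
      refine (pow_le_pow_left₀ (norm_nonneg _) (hwD t ht) M).trans ?_
      rw [mul_pow, ← exp_nat_mul]
      refine mul_le_mul_of_nonneg_left (exp_le_exp.2 ?_) (by positivity)
      have := mul_le_mul_of_nonpos_right hM (ht.trans hT0)
      linarith
    have h5 : ‖w t - Q t‖ ≤ |Cd| * exp (δ * t) := (hCd t (ht.trans hTd)).trans
      (mul_le_mul_of_nonneg_right (le_abs_self _) (exp_pos _).le)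
    have h6 : exp ((δ + α) * t) = exp (δ * t) * exp (α * t) := by rw [← exp_add]; ring_nf
    calc ‖r t‖ ≤ C * ‖w t‖ ^ M + C * (D * exp (α * t)) * ‖w t - Q t‖ := by linarith
      _ ≤ C * (D ^ M * exp ((δ + α) * t)) + C * (D * exp (α * t)) * (|Cd| * exp (δ * t)) := by
        gcongr
      _ = _ := by rw [h6]; ring
  have hPb : ∀ t : ℝ, t ≤ T → ‖P t‖ ≤ CP := fun t ht => by
    have h1 : ‖P t‖ ≤ CP * exp (α * t) := by
      simpa using hCP t (by simpa using ht.trans hT0)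
    refine h1.trans (mul_le_of_le_one_right hCP0 (exp_le_one_iff.2 ?_))
    nlinarith
  obtain ⟨s, b, hb, Cy, hCy⟩ := hA.toIsUnstablySemisimple.exists_norm_sub_sum_cexp_le
    (y := fun t => w t - P t) (r := r) (γ := δ + α) (γ' := δ + α / 2) (T := T) (M := 1 + CP)
    (by positivity) (by linarith) hT0
    (fun t _ => by
      refine ((hw t).sub (hPd t).comp_ofReal').congr_deriv ?_
      simp only [hr, map_sub]
      abel)
    hrb (fun t ht => (norm_sub_le _ _).trans
      (add_le_add ((hwD t ht).trans (hTD t ht)) (hPb t ht)))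
  have hbre : ∀ μ ∈ s, ((μ.re : ℝ) : ℂ) = μ := fun μ hμ => by
    apply Complex.ext
    · simp
    · simp [hA.im_eq_zero μ ⟨(hb μ hμ).1, (hb μ hμ).2.1⟩]
  -- The homogeneous unstable part of `w - P`; adding it to `P` makes the error `O(exp ((δ + α/2)
  -- t))` without changing the equation.
  set H : ℂ → V := ∑ μ ∈ s, fun z : ℂ => Complex.exp ((μ.re : ℝ) * z) • b μ with hH
  have hHmem : H ∈ expSums V (frequencies (unstableEigenvalues A) 1) :=
    Submodule.sum_mem _ fun μ hμ => cexp_smul_mem_expSums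
      (re_mem_frequencies (Λ := unstableEigenvalues A) ⟨(hb μ hμ).1, (hb μ hμ).2.1⟩
        (hA.im_eq_zero μ ⟨(hb μ hμ).1, (hb μ hμ).2.1⟩)) _
  have hHd : ∀ z, HasDerivAt H (A (H z)) z := by
    intro z
    refine (HasDerivAt.sum fun μ _ => hasDerivAt_cexp_smul μ.re (b μ) z).congr_deriv ?_
    rw [hH, Finset.sum_apply, map_sum]
    refine Finset.sum_congr rfl fun μ hμ => ?_
    rw [map_smul, (hb μ hμ).2.2, hbre μ hμ]
  refine ⟨P + H, Submodule.add_mem _ hP hHmem, fun z => ?_, Cy, T, fun t ht => ?_⟩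
  · refine ((hPd z).add (hHd z)).congr_deriv ?_
    simp only [Pi.add_apply, map_add]
    abel
  · have h1 : w t - (P + H) t = w t - P t - ∑ μ ∈ s, Complex.exp (μ * t) • b μ := by
      rw [Pi.add_apply, ← sub_sub, hH, Finset.sum_apply]
      congr 1
      exact Finset.sum_congr rfl fun μ hμ => by rw [hbre μ hμ]
    rw [h1]
    exact hCy t ht

/-- A solution of an entire system which converges to a nonresonant equilibrium in backward time
is an exponential sum up to arbitrarily small exponential errors, and the exponential sum is an
approximate solution on a left half-plane. -/
theorem exists_expansion [FiniteDimensional ℂ V] {f : V → V} (hf : Differentiable ℂ f)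
    (h0 : f 0 = 0) (hA : IsUnstablyNonresonant (fderiv ℂ f 0)) {w : ℝ → V}
    (hw : ∀ t, HasDerivAt w (f (w t)) t) (hw0 : Tendsto w atBot (𝓝 0)) (β : ℝ) :
    ∃ (S : Set ℝ) (Q Q' : ℂ → V) (α C T : ℝ), 0 < α ∧ 0 ≤ C ∧ T ≤ 0 ∧ Q ∈ expSums V S ∧
      (∀ z, HasDerivAt Q (Q' z) z) ∧ (∀ z : ℂ, z.re ≤ T → ‖Q z‖ ≤ C * exp (α * z.re)) ∧
      (∀ t : ℝ, t ≤ T → ‖w t - Q t‖ ≤ C * exp (β * t)) ∧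
      ∀ z : ℂ, z.re ≤ T → ‖Q' z - f (Q z)‖ ≤ C * exp (β * z.re) := by
  set A := fderiv ℂ f 0 with hAdef
  obtain ⟨α₁, C₁, T₁, hα₁, hC₁⟩ := hA.toIsUnstablySemisimple.exists_norm_le_exp (w := w)
    (r := fun t => f (w t) - A (w t)) (fun t => by simpa using hw t) (fun ε hε => by
      have h1 := (hasFDerivAt_iff_isLittleO_nhds_zero.1 (hf 0).hasFDerivAt).def hε
      filter_upwards [hw0.eventually h1] with t ht
      simpa [h0] using ht) hw0
  obtain ⟨α₂, hα₂, hle₂⟩ := Finset.exists_pos_le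
    ((Module.End.finite_hasEigenvalue (A : V →ₗ[ℂ] V)).toFinset.filter fun μ => 0 < μ.re)
    (fun μ => μ.re) (fun μ hμ => (Finset.mem_filter.1 hμ).2)
  set α := min α₁ α₂ with hαdef
  have hα : 0 < α := lt_min hα₁ hα₂
  have hle : ∀ μ ∈ unstableEigenvalues A, α ≤ μ.re := fun μ hμ =>
    (min_le_right _ _).trans (hle₂ μ (by simpa [unstableEigenvalues] using hμ))
  have hwα : ∃ C T, ∀ t ≤ T, ‖w t‖ ≤ C * exp (α * t) := by
    refine ⟨|C₁|, min T₁ 0, fun t ht => ?_⟩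
    refine (hC₁ t (ht.trans (min_le_left _ _))).trans ?_
    have ht0 : t ≤ 0 := ht.trans (min_le_right _ _)
    refine mul_le_mul (le_abs_self _) (exp_le_exp.2 ?_) (exp_pos _).le (abs_nonneg _)
    nlinarith [min_le_left α₁ α₂]
  -- Starting from the error rate `α` with `Q = 0`, each step gains `α / 2`, so `n ≥ 2 β / α` steps
  -- reach `β`. The Taylor degree `n + 2` keeps the truncation error below every error in the
  -- iteration.
  obtain ⟨n, hn⟩ := exists_nat_ge (2 * (β / α))
  obtain ⟨g, C, hC0, hg, hgexp, hfg⟩ := exists_nonlinear_part hf h0 (M := n + 2) (by omega)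
    (unstableEigenvalues A)
  have step : ∀ k : ℕ, k ≤ n → ∃ Q ∈ expSums V (frequencies (unstableEigenvalues A) 1),
      ∃ C T, ∀ t : ℝ, t ≤ T → ‖w t - Q t‖ ≤ C * exp ((α * (1 + k / 2)) * t) := by
    intro k
    induction k with
    | zero =>
      intro _
      exact ⟨0, Submodule.zero_mem _, by simpa using hwα⟩
    | succ k ih =>
      intro hk
      obtain ⟨Q, hQ, hwQ⟩ := ih (by omega)
      have hkn : (k : ℝ) + 1 ≤ n := by exact_mod_cast hk
      obtain ⟨Q', hQ', -, C', T', h⟩ := exists_expansion_step hA hα (by positivity) hle hC0 hg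
        hgexp hfg hw hwα (by push_cast; nlinarith [(Nat.cast_nonneg k : (0 : ℝ) ≤ k)]) hQ hwQ
      refine ⟨Q', hQ', C', T', fun t ht => (h t ht).trans_eq ?_⟩
      push_cast
      ring_nf
  obtain ⟨Q₀, hQ₀, hwQ₀⟩ := step n le_rfl
  set δ := α * (1 + n / 2) with hδ
  have hβδ : β ≤ δ := by
    have h1 : β / α ≤ n / 2 := by linarith
    rw [div_le_iff₀ hα] at h1
    rw [hδ]
    nlinarith
  have hMδ : β ≤ (n + 2 : ℕ) * α := by
    push_cast
    nlinarith [(Nat.cast_nonneg n : (0 : ℝ) ≤ n)]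
  -- One further step gives `Q' = A Q + g Q₀` exactly. The defect of `Q` as a solution is then
  -- governed by `Q₀ - Q`, which is small on the real axis since both sums approximate `w`, and
  -- hence on a half-plane, being an exponential sum.
  obtain ⟨Q, hQ, hQd, hwQ⟩ := exists_expansion_step hA hα (by positivity) hle hC0 hg
    hgexp hfg hw hwα (δ := δ) (by
      rw [hδ]
      push_cast
      nlinarith [(Nat.cast_nonneg n : (0 : ℝ) ≤ n)]) hQ₀ hwQ₀
  obtain ⟨C₂, T₂, hC₂⟩ := hwQ₀
  obtain ⟨C₃, T₃, hC₃⟩ := hwQ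
  have hlow : ∀ ν ∈ frequencies (unstableEigenvalues A) 1, α ≤ ν := fun ν hν => by
    simpa using mul_le_of_mem_frequencies hα.le hle hν
  obtain ⟨CQ₀, hCQ₀0, hCQ₀⟩ := exists_norm_le_of_mem_expSums hlow hQ₀
  obtain ⟨CQ, hCQ0, hCQ⟩ := exists_norm_le_of_mem_expSums hlow hQ
  have hexpδ : ∀ t : ℝ, t ≤ 0 → exp ((δ + α / 2) * t) ≤ exp (δ * t) := fun t ht =>
    exp_le_exp.2 (by nlinarith)
  have hexpβ : ∀ t : ℝ, t ≤ 0 → exp (δ * t) ≤ exp (β * t) := fun t ht =>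
    exp_le_exp.2 (by nlinarith)
  have hdiff : ∀ t : ℝ, t ≤ min (min T₂ T₃) 0 →
      ‖(Q₀ - Q) t‖ ≤ (|C₂| + |C₃|) * exp (δ * t) := by
    intro t ht
    have ht0 : t ≤ 0 := ht.trans (min_le_right _ _)
    have h1 := hC₂ t (ht.trans ((min_le_left _ _).trans (min_le_left _ _)))
    have h2 := hC₃ t (ht.trans ((min_le_left _ _).trans (min_le_right _ _)))
    have h3 : (Q₀ - Q) t = (w t - Q t) - (w t - Q₀ t) := by
      rw [Pi.sub_apply]
      abel
    rw [h3]
    refine (norm_sub_le _ _).trans ?_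
    have h4 : C₂ * exp (δ * t) ≤ |C₂| * exp (δ * t) := by
      gcongr
      exact le_abs_self _
    have h5 : C₃ * exp ((δ + α / 2) * t) ≤ |C₃| * exp (δ * t) :=
      mul_le_mul (le_abs_self _) (hexpδ t ht0) (exp_pos _).le (abs_nonneg _)
    linarith
  obtain ⟨Cd, hCd0, hCd⟩ := exists_norm_le_of_norm_ofReal_le (Submodule.sub_mem _ hQ₀ hQ) hdiff
  set D := max CQ₀ CQ with hD
  have hD0 : 0 ≤ D := le_max_of_le_right hCQ0
  obtain ⟨T, hT0, hT3, hTD⟩ : ∃ T, T ≤ 0 ∧ T ≤ T₃ ∧ ∀ t ≤ T, D * exp (α * t) ≤ 1 := by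
    have h1 : Tendsto (fun t : ℝ => D * exp (α * t)) atBot (𝓝 0) := by
      have := (tendsto_exp_atBot.comp (tendsto_id.const_mul_atBot hα)).const_mul D
      simpa using this
    obtain ⟨T, hT⟩ := eventually_atBot.1 (h1.eventually (ge_mem_nhds one_pos))
    exact ⟨min (min 0 T) T₃, by simp, by simp,
      fun t ht => hT t (ht.trans ((min_le_left _ _).trans (min_le_right _ _)))⟩
  set E := CQ + |C₃| + (C * Cd + C * CQ ^ (n + 2)) with hE
  have hE1 : 0 ≤ C * Cd + C * CQ ^ (n + 2) := by positivity
  refine ⟨_, Q, fun z => A (Q z) + g (Q₀ z), α, E, T, hα, by positivity, hT0, hQ, hQd,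
    fun z hz => ?_, fun t ht => ?_, fun z hz => ?_⟩
  · refine (hCQ z (hz.trans hT0)).trans ?_
    gcongr
    have := abs_nonneg C₃
    linarith
  · refine (hC₃ t (ht.trans hT3)).trans ?_
    have h1 : C₃ ≤ E := by
      have := le_abs_self C₃
      linarith
    refine mul_le_mul h1 ((hexpδ t (ht.trans hT0)).trans (hexpβ t (ht.trans hT0)))
      (exp_pos _).le (by positivity)
  · have hz0 := hz.trans hT0
    have hDz := hTD _ hz
    have h1 : ‖Q z‖ ≤ 1 := (hCQ z hz0).trans
      ((mul_le_mul_of_nonneg_right (le_max_right _ _) (exp_pos _).le).trans hDz)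
    have h2 : ‖Q₀ z‖ ≤ 1 := (hCQ₀ z hz0).trans
      ((mul_le_mul_of_nonneg_right (le_max_left _ _) (exp_pos _).le).trans hDz)
    have h3 := hg 1 le_rfl (Q₀ z) (Q z) h2 h1
    have h4 := hfg (Q z) h1
    have h5 : A (Q z) + g (Q₀ z) - f (Q z) =
        (g (Q₀ z) - g (Q z)) - (f (Q z) - A (Q z) - g (Q z)) := by abel
    have h6 : ‖Q z‖ ^ (n + 2) ≤ CQ ^ (n + 2) * exp (β * z.re) := by
      refine (pow_le_pow_left₀ (norm_nonneg _) (hCQ z hz0) _).trans ?_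
      rw [mul_pow, ← exp_nat_mul]
      refine mul_le_mul_of_nonneg_left (exp_le_exp.2 ?_) (by positivity)
      have := mul_le_mul_of_nonpos_right hMδ hz0
      linarith
    have h7 : ‖Q₀ z - Q z‖ ≤ Cd * exp (β * z.re) :=
      (hCd z hz0).trans (mul_le_mul_of_nonneg_left (hexpβ _ hz0) hCd0)
    rw [h5]
    calc _ ≤ ‖g (Q₀ z) - g (Q z)‖ + ‖f (Q z) - A (Q z) - g (Q z)‖ := norm_sub_le _ _
      _ ≤ C * 1 * ‖Q₀ z - Q z‖ + C * ‖Q z‖ ^ (n + 2) := add_le_add h3 h4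
      _ ≤ C * 1 * (Cd * exp (β * z.re)) + C * (CQ ^ (n + 2) * exp (β * z.re)) := by gcongr
      _ = (C * Cd + C * CQ ^ (n + 2)) * exp (β * z.re) := by ring
      _ ≤ _ := by
        gcongr
        have := abs_nonneg C₃
        linarith

end Expansion

/-! ### Boundedness on half-planes, recurrence, and the strip between -/

section Recurrence

open Real

variable {V : Type*} [NormedAddCommGroup V] [NormedSpace ℂ V]

/-- A Grönwall estimate which uses the differential inequality only inside the unit ball. -/
theorem norm_le_exp_of_norm_deriv_le {φ φ' : ℝ → V} {a b K ε δ : ℝ} (hε0 : 0 ≤ ε) (hε : ε < δ)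
    (hK : 0 ≤ K) (hφ : ∀ x ∈ Set.Icc a b, HasDerivAt φ (φ' x) x)
    (hb : ∀ x ∈ Set.Icc a b, ‖φ x‖ ≤ 1 → ‖φ' x‖ ≤ K * ‖φ x‖ + ε) (ha : ‖φ a‖ ≤ δ)
    (hδ : δ * exp ((K + 1) * (b - a)) ≤ 1) :
    ∀ x ∈ Set.Icc a b, ‖φ x‖ ≤ δ * exp ((K + 1) * (x - a)) := by
  have hB : ∀ x, HasDerivAt (fun x => δ * exp ((K + 1) * (x - a)))
      ((K + 1) * (δ * exp ((K + 1) * (x - a)))) x := by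
    intro x
    have := ((((hasDerivAt_id x).sub_const a).const_mul (K + 1)).exp).const_mul δ
    refine this.congr_deriv ?_
    simp only [id]
    ring
  intro x hx
  -- The barrier has rate `K + 1` so that `K B + ε < (K + 1) B` strictly, as `ε < δ ≤ B`; by `hδ` it
  -- stays below one, where the differential inequality is available.
  refine image_norm_le_of_norm_deriv_right_lt_deriv_boundary (f := φ) (f' := φ') (a := a) (b := b)
    (fun x hx => (hφ x hx).continuousAt.continuousWithinAt)
    (fun x hx => (hφ x ⟨hx.1, hx.2.le⟩).hasDerivWithinAt) (by simpa using ha) hB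
    (fun x hx hxB => ?_) hx
  have hδ0 : 0 < δ := hε0.trans_lt hε
  have h1 : 1 ≤ exp ((K + 1) * (x - a)) := one_le_exp (mul_nonneg (by linarith) (by linarith [hx.1]))
  have h2 : δ * exp ((K + 1) * (x - a)) ≤ δ * exp ((K + 1) * (b - a)) := by
    have := hx.2
    gcongr
  have h3 := hb x ⟨hx.1, hx.2.le⟩ (by linarith)
  rw [hxB] at h3
  nlinarith

theorem hasDerivAt_comp_add_ofReal_mul {G : ℂ → V} {z d : ℂ} {s : ℝ} {g : V}
    (h : HasDerivAt G g (z + s * d)) : HasDerivAt (fun s : ℝ => G (z + s * d)) (d • g) s := by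
  have h1 : HasDerivAt (fun s : ℂ => z + s * d) d (s : ℂ) := by
    simpa using ((hasDerivAt_id (s : ℂ)).mul_const d).const_add z
  exact (HasDerivAt.scomp (s : ℂ) h h1).comp_ofReal'

theorem exists_le_mul_exp_le {c κ ε : ℝ} (hκ : 0 < κ) (hε : 0 < ε) (T : ℝ) :
    ∃ S ≤ T, ∀ t ≤ S, c * exp (κ * t) ≤ ε := by
  have h1 : Tendsto (fun t : ℝ => c * exp (κ * t)) atBot (𝓝 0) := by
    have := (tendsto_exp_atBot.comp (tendsto_id.const_mul_atBot hκ)).const_mul c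
    simpa using this
  obtain ⟨S, hS⟩ := eventually_atBot.1 (h1.eventually (ge_mem_nhds hε))
  exact ⟨min S T, min_le_right _ _, fun t ht => hS t (ht.trans (min_le_left _ _))⟩

variable [FiniteDimensional ℂ V]

/-- A complex entire solution which emanates from a nonresonant equilibrium is bounded on a left
half-plane, and it is bounded on horizontal segments of unbounded imaginary parts. -/
theorem exists_bound_and_recurrence {f : V → V} (hf : Differentiable ℂ f)
    (h0 : f 0 = 0) (hA : IsUnstablyNonresonant (fderiv ℂ f 0)) {G : ℂ → V}
    (hG : ∀ z, HasDerivAt G (f (G z)) z) (hG0 : Tendsto (fun t : ℝ => G t) atBot (𝓝 0)) (T₁ : ℝ) :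
    ∃ T M, (∀ z : ℂ, z.re ≤ T → ‖G z‖ ≤ M) ∧ ∃ᶠ n : ℕ in atTop, ∀ t ∈ Set.Icc T T₁,
      ‖G (t + n * Complex.I)‖ ≤ M ∧ ‖G (t - n * Complex.I)‖ ≤ M := by
  have hGc : Continuous G := continuous_iff_continuousAt.2 fun z => (hG z).continuousAt
  obtain ⟨M, hM0, hM⟩ : ∃ M, 0 ≤ M ∧ ∀ t : ℝ, t ≤ T₁ → ‖G t‖ ≤ M := by
    have h1 : ∀ᶠ t : ℝ in atBot, ‖G t‖ ≤ 1 := by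
      have := hG0.norm
      rw [norm_zero] at this
      exact this.eventually (ge_mem_nhds one_pos)
    obtain ⟨t₀, ht₀⟩ := eventually_atBot.1 h1
    obtain ⟨B, hB⟩ := (isCompact_Icc (a := t₀) (b := T₁)).exists_bound_of_continuousOn
      (hGc.comp Complex.continuous_ofReal).continuousOn
    refine ⟨max 1 B, le_max_of_le_left zero_le_one, fun t ht => ?_⟩
    rcases le_total t t₀ with h | h
    · exact (ht₀ t h).trans (le_max_left _ _)
    · exact (hB t ⟨h, ht⟩).trans (le_max_right _ _)
  obtain ⟨K, hK0, hK⟩ := exists_norm_sub_le_of_differentiable hf (M + 2)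
  -- One unit above `K + 1` and an expansion of order `β + 1`: the spare unit absorbs constants that
  -- depend on the imaginary part.
  set β := K + 2 with hβ
  obtain ⟨S, Q, Q', α, C, T₀, hα, hC0, hT₀, hQ, hQd, hQb, hGQ, hdef⟩ :=
    exists_expansion hf h0 hA (w := fun t => G t) (fun t => (hG t).comp_ofReal') hG0 (β + 1)
  set D := C + 1 with hD
  obtain ⟨T₂, hT₂₀, hT₂⟩ := exists_le_mul_exp_le (c := C) hα one_pos T₀
  obtain ⟨T₃, hT₃₂, hT₃⟩ := exists_le_mul_exp_le (c := D) (by linarith : 0 < β) one_pos T₂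
  have hQ1 : ∀ z : ℂ, z.re ≤ T₂ → ‖Q z‖ ≤ 1 := fun z hz =>
    (hQb z (hz.trans hT₂₀)).trans (hT₂ _ hz)
  set R : ℂ → V := fun z => G z - Q z with hR
  have hRd : ∀ z, HasDerivAt R (f (G z) - Q' z) z := fun z => (hG z).sub (hQd z)
  have hRb : ∀ z : ℂ, z.re ≤ T₂ → ‖R z‖ ≤ 1 →
      ‖f (G z) - Q' z‖ ≤ K * ‖R z‖ + C * exp ((β + 1) * z.re) := by
    intro z hz h1
    have h2 := hQ1 z hz
    have h3 : ‖G z‖ ≤ 2 := by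
      have h4 : G z = R z + Q z := by simp [hR]
      rw [h4]
      exact (norm_add_le _ _).trans (by linarith)
    have h5 := hK (Q z) (G z) (by linarith) (by linarith)
    have h6 := hdef z (hz.trans hT₂₀)
    have h7 : f (G z) - Q' z = (f (G z) - f (Q z)) - (Q' z - f (Q z)) := by abel
    rw [h7]
    exact (norm_sub_le _ _).trans (add_le_add h5 h6)
  -- Grönwall from `t` to `t + σ i`. The constant depends on `σ`, so this alone gives no uniform
  -- bound.
  have hvert : ∀ σ : ℝ, ∃ c S, ∀ t : ℝ, t ≤ S → ‖R (t + σ * Complex.I)‖ ≤ c * exp ((β + 1) * t) := by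
    intro σ
    set c := C + |σ| * C + 1 with hc
    have hc0 : 0 ≤ |σ| * C := by positivity
    obtain ⟨S, hS₂, hS⟩ := exists_le_mul_exp_le (c := c * exp (|σ| * K + 1))
      (by linarith : 0 < β + 1) one_pos T₂
    refine ⟨c * exp (|σ| * K + 1), S, fun t ht => ?_⟩
    have hre : ∀ s : ℝ, ((t : ℂ) + s * (σ * Complex.I)).re = t := fun s => by simp
    have hexp := exp_pos ((β + 1) * t)
    have h1 := norm_le_exp_of_norm_deriv_le
      (φ := fun s : ℝ => R ((t : ℂ) + s * (σ * Complex.I)))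
      (φ' := fun s : ℝ => ((σ : ℂ) * Complex.I) •
        (f (G ((t : ℂ) + s * (σ * Complex.I))) - Q' ((t : ℂ) + s * (σ * Complex.I))))
      (a := 0) (b := 1) (K := |σ| * K) (ε := |σ| * C * exp ((β + 1) * t))
      (δ := c * exp ((β + 1) * t)) (by positivity) (by
        refine mul_lt_mul_of_pos_right ?_ hexp
        rw [hc]
        linarith) (by positivity)
      (fun s _ => hasDerivAt_comp_add_ofReal_mul (hRd _))
      (fun s _ hs => by
        have := hRb _ ((hre s).le.trans (ht.trans hS₂)) hs
        rw [hre] at this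
        rw [norm_smul, norm_mul, Complex.norm_I, mul_one, Complex.norm_real, norm_eq_abs]
        calc _ ≤ |σ| * _ := mul_le_mul_of_nonneg_left this (abs_nonneg σ)
          _ = _ := by ring)
      (by
        have h2 := hGQ t (ht.trans (hS₂.trans hT₂₀))
        have h3 : C * exp ((β + 1) * t) ≤ c * exp ((β + 1) * t) := by
          gcongr
          rw [hc]
          linarith
        simpa [hR] using h2.trans h3)
      (by
        have := hS t ht
        rw [sub_zero, mul_one]
        linarith) 1 (by simp)
    simp only [Complex.ofReal_one, one_mul, sub_zero, mul_one] at h1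
    linarith
  -- Grönwall along the horizontal line through `z`, started so far to the left that `c exp ((β + 1)
  -- a) ≤ D exp (β a)`. The barrier `D exp (β s)` is not crossed because `K D + C < β D`; its
  -- constant no longer depends on `Im z`.
  have hhor : ∀ z : ℂ, z.re ≤ T₃ → ‖R z‖ ≤ D * exp (β * z.re) := by
    intro z hz
    obtain ⟨c, S, hcS⟩ := hvert z.im
    obtain ⟨a, haS, ha⟩ := exists_le_mul_exp_le (c := c) (ε := D) one_pos (by positivity)
      (min S z.re)
    have hre : ∀ s : ℝ, ((z.im : ℂ) * Complex.I + s * 1).re = s := fun s => by simp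
    have hB : ∀ x, HasDerivAt (fun x => D * exp (β * x)) (β * (D * exp (β * x))) x := by
      intro x
      have := (((hasDerivAt_id x).const_mul β).exp).const_mul D
      refine this.congr_deriv ?_
      simp only [id]
      ring
    have hd : ∀ s : ℝ, HasDerivAt (fun s : ℝ => R ((z.im : ℂ) * Complex.I + s * 1))
        ((1 : ℂ) • (f (G ((z.im : ℂ) * Complex.I + s * 1)) -
          Q' ((z.im : ℂ) * Complex.I + s * 1))) s :=
      fun s => hasDerivAt_comp_add_ofReal_mul (hRd _)
    have h1 := image_norm_le_of_norm_deriv_right_lt_deriv_boundary (a := a) (b := z.re)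
      (fun s _ => (hd s).continuousAt.continuousWithinAt) (fun s _ => (hd s).hasDerivWithinAt)
      (by
        have h2 := hcS a (haS.trans (min_le_left _ _))
        have h3 : c * exp ((β + 1) * a) ≤ D * exp (β * a) := by
          have h4 := mul_le_mul_of_nonneg_right (ha a le_rfl) (exp_pos (β * a)).le
          rw [mul_assoc, ← exp_add] at h4
          rwa [show 1 * a + β * a = (β + 1) * a by ring] at h4
        rw [mul_one, add_comm]
        exact h2.trans h3) hB
      (fun s hs hsB => by
        have hsz : s ≤ T₃ := hs.2.le.trans hz
        have h4 := hRb ((z.im : ℂ) * Complex.I + s * 1) ((hre s).le.trans (hsz.trans hT₃₂))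
          (hsB.le.trans (hT₃ s hsz))
        rw [hsB, hre] at h4
        rw [one_smul]
        refine h4.trans_lt ?_
        have h5 : exp ((β + 1) * s) ≤ exp (β * s) := exp_le_exp.2 (by linarith)
        have h6 := exp_pos (β * s)
        have h7 : C * exp ((β + 1) * s) ≤ C * exp (β * s) := by gcongr
        rw [hβ, hD] at *
        nlinarith) (x := z.re) ⟨haS.trans (min_le_right _ _), le_rfl⟩
    have h8 : ((z.im : ℂ) * Complex.I + z.re * 1) = z := by
      rw [mul_one, add_comm, Complex.re_add_im]
    rwa [h8] at h1
  -- As `β = K + 2`, the remainder at `T` stays small even after growth by `exp ((K + 1) (T₁ - T))`.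
  -- Below, `η` is the inverse of this growth, so an initial distance `η / 2` between `G` and its
  -- vertical translate stays at most one up to `T₁`.
  obtain ⟨T, hT₃', hT⟩ := exists_le_mul_exp_le (c := 2 * D * exp ((K + 1) * T₁)) (ε := 1 / 4)
    one_pos (by norm_num) (min T₃ T₁)
  have hTT₃ : T ≤ T₃ := hT₃'.trans (min_le_left _ _)
  have hTT₁ : T ≤ T₁ := hT₃'.trans (min_le_right _ _)
  refine ⟨T, M + 2, fun z hz => ?_, ?_⟩
  · have h1 := (hhor z (hz.trans hTT₃)).trans (hT₃ _ (hz.trans hTT₃))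
    have h2 := hQ1 z (hz.trans (hTT₃.trans hT₃₂))
    have h3 : G z = R z + Q z := by simp [hR]
    rw [h3]
    exact (norm_add_le _ _).trans (by linarith)
  · set η := exp (-((K + 1) * (T₁ - T))) with hη
    have hη0 : 0 < η := exp_pos _
    have hηT : 2 * D * exp (β * T) ≤ η / 4 := by
      have h1 := mul_le_mul_of_nonneg_right (hT T le_rfl) hη0.le
      calc 2 * D * exp (β * T) = 2 * D * exp ((K + 1) * T₁) * exp (1 * T) * η := by
            have : exp (β * T) = exp ((K + 1) * T₁) * exp (1 * T) * η := by
              rw [hη, ← exp_add, ← exp_add, hβ]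
              ring_nf
            rw [this]
            ring
        _ ≤ _ := by linarith
    have key : ∀ d : ℂ, d.re = 0 → ‖Q (T + d) - Q T‖ < η / 4 →
        ∀ t ∈ Set.Icc T T₁, ‖G (t + d)‖ ≤ M + 2 := by
      intro d hd hQT t ht
      have hRT : ∀ z : ℂ, z.re = T → ‖R z‖ ≤ D * exp (β * T) := fun z hz => by
        have := hhor z (hz.le.trans hTT₃)
        rwa [hz] at this
      have h1 : ‖G (T + d) - G T‖ ≤ η / 2 := by
        have h2 : G (T + d) - G T = (Q (T + d) - Q T) + (R (T + d) - R T) := by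
          simp only [hR]
          abel
        have h3 := hRT (T + d) (by simp [hd])
        have h4 := hRT T (by simp)
        rw [h2]
        refine (norm_add_le _ _).trans ?_
        have := norm_sub_le (R (T + d)) (R T)
        linarith
      have h5 := norm_le_exp_of_norm_deriv_le (φ := fun t : ℝ => G (t + d) - G t)
        (φ' := fun t : ℝ => f (G (t + d)) - f (G t)) (a := T) (b := T₁) (K := K) (ε := 0)
        (δ := η / 2) le_rfl (by positivity) hK0
        (fun t _ => by
          have h6 : HasDerivAt (fun t : ℝ => G (t + d)) (f (G (t + d))) t :=
            ((hG (t + d)).comp_add_const (t : ℂ) d).comp_ofReal'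
          exact h6.sub (hG t).comp_ofReal')
        (fun t ht h7 => by
          rw [add_zero]
          have h8 := hM t ht.2
          have h9 := norm_add_le (G (t + d) - G t) (G t)
          rw [sub_add_cancel] at h9
          exact hK _ _ (by linarith) (by linarith)) h1
        (by
          rw [hη, div_mul_eq_mul_div, ← exp_add]
          norm_num)
      have h6 : ‖G (t + d) - G t‖ ≤ 1 := by
        refine (h5 t ht).trans ?_
        have h7 : exp ((K + 1) * (t - T)) ≤ exp ((K + 1) * (T₁ - T)) := by
          have := ht.2
          gcongr
        have h8 : η * exp ((K + 1) * (T₁ - T)) = 1 := by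
          rw [hη, ← exp_add]
          simp
        nlinarith
      have h9 := norm_add_le (G (t + d) - G t) (G t)
      rw [sub_add_cancel] at h9
      have := hM t ht.2
      linarith
    refine (frequently_norm_sub_lt_of_mem_expSums hQ T (by positivity : 0 < η / 4)).mono
      fun n hn t ht => ⟨key _ (by simp) hn.1 t ht, ?_⟩
    have := key (-(n * Complex.I)) (by simp) (by simpa [sub_eq_add_neg] using hn.2) t ht
    simpa [sub_eq_add_neg] using this

/-- Version of `exists_bound_and_recurrence` at an arbitrary equilibrium. -/
theorem exists_bound_and_recurrence_of_tendsto {F : V → V} (hF : Differentiable ℂ F) {v : V}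
    (hv : F v = 0) (hA : IsUnstablyNonresonant (fderiv ℂ F v)) {G : ℂ → V}
    (hG : ∀ z, HasDerivAt G (F (G z)) z) (hGv : Tendsto (fun t : ℝ => G t) atBot (𝓝 v)) (T₁ : ℝ) :
    ∃ T M, (∀ z : ℂ, z.re ≤ T → ‖G z‖ ≤ M) ∧ ∃ᶠ n : ℕ in atTop, ∀ t ∈ Set.Icc T T₁,
      ‖G (t + n * Complex.I)‖ ≤ M ∧ ‖G (t - n * Complex.I)‖ ≤ M := by
  have hbound : ∀ {z : ℂ} {M : ℝ}, ‖G z - v‖ ≤ M → ‖G z‖ ≤ M + ‖v‖ := fun {z M} h => by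
    have := norm_add_le (G z - v) v
    rw [sub_add_cancel] at this
    linarith
  obtain ⟨T, M, h1, h2⟩ := exists_bound_and_recurrence (f := fun y => F (v + y))
    (hF.comp (differentiable_id.const_add v)) (by simpa using hv)
    (by rw [fderiv_comp_add_left]; simpa using hA) (G := fun z => G z - v)
    (fun z => by simpa using (hG z).sub_const v) (by simpa using hGv.sub_const v) T₁
  exact ⟨T, M + ‖v‖, fun z hz => hbound (h1 z hz),
    h2.mono fun n hn t ht => ⟨hbound (hn t ht).1, hbound (hn t ht).2⟩⟩

/-- Entire heteroclinic solutions between nonresonant equilibria are bounded. -/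
theorem exists_norm_le_of_heteroclinic {F : V → V} (hF : Differentiable ℂ F) {v₁ v₂ : V}
    (hv₁ : F v₁ = 0) (hv₂ : F v₂ = 0) (hA₁ : IsUnstablyNonresonant (fderiv ℂ F v₁))
    (hA₂ : IsUnstablyNonresonant (-fderiv ℂ F v₂)) {G : ℂ → V}
    (hG : ∀ z, HasDerivAt G (F (G z)) z) (h₁ : Tendsto (fun t : ℝ => G t) atBot (𝓝 v₁))
    (h₂ : Tendsto (fun t : ℝ => G t) atTop (𝓝 v₂)) : ∃ M, ∀ z, ‖G z‖ ≤ M := by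
  obtain ⟨T₂, M₂, hM₂, -⟩ := exists_bound_and_recurrence_of_tendsto (F := fun y => -F y) (v := v₂) hF.neg
    (by simp [hv₂]) (by rwa [fderiv_fun_neg]) (G := fun z => G (-z))
    (fun z => by
      have := HasDerivAt.scomp z (hG (-z)) (hasDerivAt_neg z)
      simpa [Function.comp_def] using this)
    (by simpa [Function.comp_def] using h₂.comp tendsto_neg_atBot_atTop) 0
  -- The right half-plane is fixed first, so that the recurrent segments at `v₁` can be requested up
  -- to its edge `-T₂`.
  obtain ⟨T₁, M₁, hM₁, hrec⟩ := exists_bound_and_recurrence_of_tendsto hF hv₁ hA₁ hG h₁ (-T₂)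
  have hGd : Differentiable ℂ G := fun z => (hG z).differentiableAt
  refine ⟨max M₁ M₂, fun z => ?_⟩
  have hleft : ∀ z : ℂ, z.re ≤ T₁ → ‖G z‖ ≤ max M₁ M₂ := fun z hz =>
    (hM₁ z hz).trans (le_max_left _ _)
  have hright : ∀ z : ℂ, -T₂ ≤ z.re → ‖G z‖ ≤ max M₁ M₂ := fun z hz => by
    have := hM₂ (-z) (by rw [Complex.neg_re]; linarith)
    rw [neg_neg] at this
    exact this.trans (le_max_right _ _)
  rcases le_or_gt z.re T₁ with h | hz₁
  · exact hleft z h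
  rcases le_or_gt (-T₂) z.re with h | hz₂
  · exact hright z h
  obtain ⟨m, hm⟩ := exists_nat_gt |z.im|
  obtain ⟨n, hmn, hn⟩ := frequently_atTop.1 hrec m
  have hzn : |z.im| < n := hm.trans_le (by exact_mod_cast hmn)
  rw [abs_lt] at hzn
  have hn0 : -(n : ℝ) < n := hzn.1.trans hzn.2
  -- Maximum principle on a rectangle around `z`: its vertical sides lie in the half-planes, its
  -- horizontal sides are recurrent segments.
  refine Complex.norm_le_of_forall_mem_frontier_norm_le
    (U := Set.Ioo T₁ (-T₂) ×ℂ Set.Ioo (-(n : ℝ)) n)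
    ((Metric.isBounded_Ioo _ _).reProdIm (Metric.isBounded_Ioo _ _)) hGd.diffContOnCl ?_
    (subset_closure ⟨⟨hz₁, hz₂⟩, hzn⟩)
  intro x hx
  rw [Complex.frontier_reProdIm, closure_Ioo (hz₁.trans hz₂).ne, closure_Ioo hn0.ne,
    frontier_Ioo (hz₁.trans hz₂), frontier_Ioo hn0] at hx
  rcases hx with ⟨hre, him⟩ | ⟨hre, -⟩
  · have hx' := hn x.re hre
    have hxe : x = x.re + x.im * Complex.I := (Complex.re_add_im x).symm
    rcases him with him | him
    · have him' : x.im = -(n : ℝ) := him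
      have : x = x.re - n * Complex.I := by
        rw [hxe, him']
        simp [sub_eq_add_neg]
      rw [this]
      exact hx'.2.trans (le_max_left _ _)
    · have him' : x.im = (n : ℝ) := him
      have : x = x.re + n * Complex.I := by
        rw [hxe, him']
        simp
      rw [this]
      exact hx'.1.trans (le_max_left _ _)
  · rcases hre with hre | hre
    · exact hleft x (le_of_eq hre)
    · exact hright x (le_of_eq (Eq.symm hre))

end Recurrence

/-! ### Time reversal: `-A` in place of `A` -/

section TimeReversal

theorem eigenspace_neg {V : Type*} [AddCommGroup V] [Module ℂ V] (A : Module.End ℂ V)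
    (μ : ℂ) : Module.End.eigenspace (-A) μ = A.eigenspace (-μ) := by
  ext x
  rw [Module.End.mem_eigenspace_iff, Module.End.mem_eigenspace_iff, LinearMap.neg_apply,
    neg_smul, neg_eq_iff_eq_neg]

theorem hasEigenvalue_neg_iff {V : Type*} [AddCommGroup V] [Module ℂ V] {A : Module.End ℂ V}
    {μ : ℂ} : Module.End.HasEigenvalue (-A) μ ↔ A.HasEigenvalue (-μ) := by
  rw [Module.End.hasEigenvalue_iff, Module.End.hasEigenvalue_iff, eigenspace_neg]

theorem maxGenEigenspace_neg {V : Type*} [AddCommGroup V] [Module ℂ V] (A : Module.End ℂ V)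
    (μ : ℂ) : Module.End.maxGenEigenspace (-A) μ = A.maxGenEigenspace (-μ) := by
  ext x
  rw [Module.End.mem_maxGenEigenspace, Module.End.mem_maxGenEigenspace]
  have h : -A - μ • (1 : Module.End ℂ V) = -(A - (-μ) • (1 : Module.End ℂ V)) := by
    rw [neg_smul]
    abel
  refine exists_congr fun k => ?_
  rw [h, neg_pow]
  rcases neg_one_pow_eq_or (Module.End ℂ V) k with hk | hk <;> simp [hk]

theorem Nonresonant.neg {S : Set ℂ} (hS : Nonresonant S) : Nonresonant (-S) := by
  intro μ₀ hμ₀ n hn h2 he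
  refine hS (-μ₀) hμ₀ (n.mapDomain fun μ => -μ) ?_ ?_ ?_
  · intro x hx
    classical
    obtain ⟨y, hy, rfl⟩ := Finset.mem_image.1 (Finsupp.mapDomain_support hx)
    exact hn hy
  · rwa [Finsupp.sum_mapDomain_index (by simp) (by simp)]
  · rw [Finsupp.sum_mapDomain_index (by simp) (by intros; push_cast; ring), he, Finsupp.sum,
      Finsupp.sum, ← Finset.sum_neg_distrib]
    simp

end TimeReversal

/-! ### From the real heteroclinic orbit to the complex equation -/

section Statement

variable {N : ℕ} {F : (Fin N → ℂ) → (Fin N → ℂ)} {f : (Fin N → ℝ) → (Fin N → ℝ)} {v : Fin N → ℝ}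

theorem IsHyperbolicEquilibrium.isUnstablyNonresonant (hv : IsHyperbolicEquilibrium F f v)
    (h : RealSemisimpleNonresonant (linearization F v) (unstableSpectrum (linearization F v))) :
    IsUnstablyNonresonant (fderiv ℂ F (complexify v)) where
  re_ne_zero := hv.2
  semisimple μ hμ hre := (h.2.1 μ ⟨hμ, hre⟩).2
  im_eq_zero := h.1
  nonresonant := h.2.2

/-- Reversal of time turns the stable eigenvalues into unstable ones, so the analysis at `-∞` also
covers the limit at `+∞`. -/
theorem IsHyperbolicEquilibrium.isUnstablyNonresonant_neg (hv : IsHyperbolicEquilibrium F f v)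
    (h : RealSemisimpleNonresonant (linearization F v) (stableSpectrum (linearization F v))) :
    IsUnstablyNonresonant (-fderiv ℂ F (complexify v)) := by
  have hcoe : ((-fderiv ℂ F (complexify v) : (Fin N → ℂ) →L[ℂ] (Fin N → ℂ)) :
      (Fin N → ℂ) →ₗ[ℂ] (Fin N → ℂ)) = -linearization F v := rfl
  have hS : unstableEigenvalues (-fderiv ℂ F (complexify v)) =
      -stableSpectrum (linearization F v) := by
    ext μ
    rw [unstableEigenvalues, Set.mem_neg, stableSpectrum, Set.mem_ofPred_eq, Set.mem_ofPred_eq, hcoe,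
      hasEigenvalue_neg_iff, Complex.neg_re, neg_lt_zero]
  have hmem : ∀ μ, Module.End.HasEigenvalue (-linearization F v) μ → 0 < μ.re →
      -μ ∈ stableSpectrum (linearization F v) := fun μ hμ hre =>
    ⟨hasEigenvalue_neg_iff.1 hμ, by simpa using hre⟩
  refine ⟨⟨fun μ hμ => ?_, fun μ hμ hre => ?_⟩, fun μ hμ => ?_, ?_⟩
  · rw [hcoe] at hμ
    simpa using hv.2 (-μ) (hasEigenvalue_neg_iff.1 hμ)
  · rw [hcoe] at hμ ⊢
    rw [maxGenEigenspace_neg, eigenspace_neg]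
    exact (h.2.1 (-μ) (hmem μ hμ hre)).2
  · rw [hS] at hμ
    simpa using h.1 (-μ) hμ
  · rw [hS]
    exact h.2.2.neg

theorem continuous_complexify : Continuous (complexify : (Fin N → ℝ) → (Fin N → ℂ)) :=
  continuous_pi fun i => Complex.continuous_ofReal.comp (continuous_apply i)

theorem complexify_injective : Function.Injective (complexify : (Fin N → ℝ) → (Fin N → ℂ)) :=
  fun _ _ h => funext fun i => Complex.ofReal_injective (congrFun h i)

theorem HasDerivAt.complexify {Γ : ℝ → (Fin N → ℝ)} {x : Fin N → ℝ} {t : ℝ}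
    (h : HasDerivAt Γ x t) : HasDerivAt (fun t => _root_.complexify (Γ t)) (_root_.complexify x) t :=
  hasDerivAt_pi.2 fun i => (hasDerivAt_pi.1 h i).ofReal_comp

/-- The entire extension of a real solution solves the complexified equation. -/
theorem hasDerivAt_of_entire_extension (hF : IsEntireExtension F f) {Γ : ℝ → (Fin N → ℝ)}
    (hΓ : ∀ t, HasDerivAt Γ (f (Γ t)) t) {G : ℂ → (Fin N → ℂ)} (hG : Differentiable ℂ G)
    (hGΓ : ∀ t : ℝ, G t = complexify (Γ t)) (z : ℂ) : HasDerivAt G (F (G z)) z := by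
  have hreal : ∀ t : ℝ, deriv G t = F (G t) := by
    intro t
    have h1 : HasDerivAt (fun t : ℝ => G t) (deriv G t) t := (hG t).hasDerivAt.comp_ofReal'
    have h2 : HasDerivAt (fun t : ℝ => G t) (complexify (f (Γ t))) t := by
      rw [funext hGΓ]
      exact (hΓ t).complexify
    rw [h1.unique h2, hGΓ, hF.2]
  have heq : deriv G = fun z => F (G z) := by
    -- Identity theorem: the two sides agree at the real points `1 / (n + 1)`, which accumulate at
    -- `0`.
    refine AnalyticOnNhd.eq_of_frequently_eq (z₀ := 0)
      (fun z _ => (Differentiable.analyticAt hG z).deriv)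
      (fun z _ => Differentiable.analyticAt (hF.1.comp hG) z) ?_
    have h1 : Tendsto (fun n : ℕ => ((1 / ((n : ℝ) + 1) : ℝ) : ℂ)) atTop (𝓝[≠] 0) := by
      refine tendsto_nhdsWithin_iff.2 ⟨?_, Eventually.of_forall fun n => ?_⟩
      · exact (Complex.continuous_ofReal.tendsto 0).comp tendsto_one_div_add_atTop_nhds_zero_nat
      · have : (0 : ℝ) < 1 / ((n : ℝ) + 1) := by positivity
        exact Complex.ofReal_ne_zero.2 this.ne'
    exact h1.frequently (Frequently.of_forall fun n => hreal _)
  rw [← congrFun heq z]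
  exact (hG z).hasDerivAt

end Statement

theorem theorem1p2 {N : ℕ}
    (f : (Fin N → ℝ) → (Fin N → ℝ)) (F : (Fin N → ℂ) → (Fin N → ℂ))
    (hF : IsEntireExtension F f)
    (vm vp : Fin N → ℝ)
    (hvm : IsHyperbolicEquilibrium F f vm) (hvp : IsHyperbolicEquilibrium F f vp)
    (hunstable : RealSemisimpleNonresonant (linearization F vm)
      (unstableSpectrum (linearization F vm)))
    (hstable : RealSemisimpleNonresonant (linearization F vp)
      (stableSpectrum (linearization F vp)))
    (Γ : ℝ → (Fin N → ℝ)) (hΓ : IsHeteroclinicOrbit f vm vp Γ) :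
    ¬ IsComplexEntireInTime Γ := by
  rintro ⟨G, hG, hGΓ⟩
  obtain ⟨hne, hode, hm, hp⟩ := hΓ
  have hzero : ∀ {v}, IsHyperbolicEquilibrium F f v → F (complexify v) = 0 := fun {v} hv => by
    rw [hF.2, hv.1]
    funext i
    simp [complexify]
  have hm' : Tendsto (fun t : ℝ => G t) atBot (𝓝 (complexify vm)) := by
    rw [funext hGΓ]
    exact (continuous_complexify.tendsto vm).comp hm
  have hp' : Tendsto (fun t : ℝ => G t) atTop (𝓝 (complexify vp)) := by
    rw [funext hGΓ]
    exact (continuous_complexify.tendsto vp).comp hp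
  obtain ⟨M, hM⟩ := exists_norm_le_of_heteroclinic hF.1 (hzero hvm) (hzero hvp)
    (hvm.isUnstablyNonresonant hunstable) (hvp.isUnstablyNonresonant_neg hstable)
    (hasDerivAt_of_entire_extension hF hode hG hGΓ) hm' hp'
  have hb : Bornology.IsBounded (Set.range G) :=
    isBounded_iff_forall_norm_le.2 ⟨M, by rintro _ ⟨z, rfl⟩; exact hM z⟩
  obtain ⟨c, hc⟩ := hG.exists_const_forall_eq_of_bounded hb
  simp only [hc] at hm' hp'
  exact hne (complexify_injective ((tendsto_nhds_unique hm' tendsto_const_nhds).trans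
    (tendsto_nhds_unique hp' tendsto_const_nhds).symm))
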